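/- Let $B\ge 1$ and let $f:\mathbb{N}\to\mathbb{C}$ be a multiplicative function with $|f(n)|\le B$ for all $n$. For a positive integer $N$ and real $\alpha$ put $S(\alpha)=\sum_{n=1}^{N} f(n)e^{2\pi i n\alpha}$. Let $a$ and $q\ge 1$ be coprime integers with $|\alpha-a/q|\le q^{-2}$, and let $E\ge 4$ and $R>e$ be real numbers with $e^3/E\le R\le q\le N/R$. Then \[ |S(\alpha)|\le c_1(B,E,R)\,\frac{N}{\log N}+c_2(B,E,R,q)\,\frac{N(\log(ER))^{3/2}}{\sqrt{R}}, \] where, with $C$ the Euler--Mascheroni constant, \begin{align*} c_1(B,E,R)&=(1+2\pi)\,b_1(B,E)+2\pi B\,\frac{2\log R}{R^2},\\ c_2(B,E,R,q)&=(1+2\pi)\left(b_2(B,E)\,\frac{\left(e^{C}\log\log R+\frac{2.51}{\log\log R}\right)^{1/2}}{(\log(ER))^{3/2}}+b_3(B,E,R,q)\right),\\ b_1(B,E)&=B+9.82B^2+8.12(a_1+a_4)E+18.9a_3+3.46a_1+4.06a_4,\\ b_2(B,E)&=a_2\,\frac{\sqrt2\,E+1}{\log 2},\\ b_3(B,E,R,q)&=B^2\,\frac{7.63}{\sqrt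 E}\,\frac{\log(4ER)}{(\log(ER))^{3/2}}\left(1+\frac{\log(64/E)+1}{\log q}\right)+1.48a_5+\frac{1.48a_6}{\sqrt{\log(ER)}}\\ &\qquad+\frac{a_5}{\log 2}\,\frac{\log(2R)}{(\log(ER))^{3/2}}+\frac{a_6}{\log 2}\,\frac{1}{(\log(ER))^{3/2}}, \end{align*} and $a_1=1.59B^2$, $a_2=\frac{\pi^2}{6}zB^2$, $a_3=a_5=0.96\,zB^2$, $a_4=zB^2$, $a_6=1.32\,zB^2$, with \[ z=8\sqrt{2\prod_{p>2}\left(1+\frac{1}{p^3-p^2-2p}\right)}, \] the product running over the odd primes $p$. -/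

import Mathlib

namespace MontgomeryVaughan

noncomputable section

/-- `e(x) = exp(2πix)`. -/
def e (x : ℝ) : ℂ := Complex.exp (2 * Real.pi * Complex.I * x)

/-- The class `F` of multiplicative functions bounded by `B`. -/
def BoundedMultiplicative (B : ℝ) (f : ArithmeticFunction ℂ) : Prop :=
  f.IsMultiplicative ∧ ∀ n : ℕ, ‖f n‖ ≤ B

/-- `S(α) = ∑_{n=1}^N f(n) e(nα)`. -/
def S (f : ArithmeticFunction ℂ) (N : ℕ) (α : ℝ) : ℂ :=
  ∑ n ∈ Finset.Icc 1 N, f n * e (n * α)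

/-- The factor at `p` of the product `∏_{p>2} (1 + 1/(p³-p²-2p))` over the odd primes. -/
def oddPrimeFactor (p : {p : ℕ // p.Prime ∧ 2 < p}) : ℝ :=
  1 + 1 / ((p : ℝ) ^ 3 - (p : ℝ) ^ 2 - 2 * (p : ℝ))

/-- The infinite product below converges absolutely. -/
theorem multipliable_oddPrimeFactor : Multipliable oddPrimeFactor := by
  have key : ∀ p : {p : ℕ // p.Prime ∧ 2 < p},
      ((p : ℕ) : ℝ) ^ 2 / 3 ≤ (p : ℝ) ^ 3 - (p : ℝ) ^ 2 - 2 * (p : ℝ) := by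
    intro p
    have h : (3 : ℝ) ≤ ((p : ℕ) : ℝ) := by exact_mod_cast p.2.2
    nlinarith [mul_nonneg (sub_nonneg.2 h) (sq_nonneg ((p : ℕ) : ℝ)), sq_nonneg ((p : ℕ) : ℝ)]
  have hs : Summable fun p : {p : ℕ // p.Prime ∧ 2 < p} =>
      1 / ((p : ℝ) ^ 3 - (p : ℝ) ^ 2 - 2 * (p : ℝ)) := by
    have h2 : Summable fun p : {p : ℕ // p.Prime ∧ 2 < p} => 3 * (1 / ((p : ℕ) : ℝ) ^ 2) :=
      ((Real.summable_one_div_nat_pow.2 one_lt_two).subtype _).mul_left 3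
    refine Summable.of_nonneg_of_le (fun p => ?_) (fun p => ?_) h2
    · have hp : (0 : ℝ) < ((p : ℕ) : ℝ) := by exact_mod_cast p.2.1.pos
      have := key p
      exact one_div_nonneg.2 (le_trans (by positivity) this)
    · have hp : (0 : ℝ) < ((p : ℕ) : ℝ) := by exact_mod_cast p.2.1.pos
      calc _ ≤ 1 / (((p : ℕ) : ℝ) ^ 2 / 3) := one_div_le_one_div_of_le (by positivity) (key p)
        _ = _ := by field_simp
  exact Real.multipliable_one_add_of_summable hs

/-- `z = 8 √(2 ∏_{p>2} (1 + 1/(p³-p²-2p)))`. -/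
def z : ℝ := 8 * √(2 * ∏' p : {p : ℕ // p.Prime ∧ 2 < p}, oddPrimeFactor p)

def a₁ (B : ℝ) : ℝ := B ^ 2 * 1.59
def a₂ (B : ℝ) : ℝ := B ^ 2 * z * (Real.pi ^ 2 / 6)
def a₃ (B : ℝ) : ℝ := B ^ 2 * z * 0.96
def a₄ (B : ℝ) : ℝ := B ^ 2 * z
def a₅ (B : ℝ) : ℝ := B ^ 2 * z * 0.96
def a₆ (B : ℝ) : ℝ := B ^ 2 * 1.32 * z

def b₁ (B E : ℝ) : ℝ :=
  B + 9.82 * B ^ 2 + 8.12 * (a₁ B + a₄ B) * E + 18.9 * a₃ B + 3.46 * a₁ B + 4.06 * a₄ B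

def b₂ (B E : ℝ) : ℝ := a₂ B * ((√2 * E + 1) / Real.log 2)

def b₃ (B E R q : ℝ) : ℝ :=
  B ^ 2 * (7.63 / √E) * (Real.log (4 * E * R) / Real.log (E * R) ^ (3 / 2 : ℝ))
      * (1 + (Real.log (64 / E) + 1) / Real.log q)
    + a₅ B * 1.48
    + 1.48 * (a₆ B / √(Real.log (E * R)))
    + a₅ B / Real.log 2 * (Real.log (2 * R) / Real.log (E * R) ^ (3 / 2 : ℝ))
    + a₆ B / Real.log 2 * (1 / Real.log (E * R) ^ (3 / 2 : ℝ))

def c₁ (B E R : ℝ) : ℝ :=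
  (1 + 2 * Real.pi) * b₁ B E + B * (2 * Real.pi) * (2 * Real.log R / R ^ 2)

def c₂ (B E R q : ℝ) : ℝ :=
  (1 + 2 * Real.pi) *
    (b₂ B E *
        ((Real.exp Real.eulerMascheroniConstant * Real.log (Real.log R)
            + 2.51 / Real.log (Real.log R)) ^ (1 / 2 : ℝ)
          / Real.log (E * R) ^ (3 / 2 : ℝ))
      + b₃ B E R q)

end

end MontgomeryVaughan

namespace MontgomeryVaughan

open Finset

/-! ### Sums of periodic functions -/

/-! The constants are large: `c₁_ge` and `c₂_ge` give `c₁ ≥ 4000 B²` and `c₂ ≥ 80 B²`. Since `4R ≤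
ER`, it is enough to bound `|S(α)|` by `4000 B² N / log N + 80 B² N L^{3/2} / √R` with `L = log 4R`,
which is `norm_S_le_of_approx`. If this bound exceeds the trivial `BN` there is nothing to prove;
otherwise `N` and `R` are so large that `L ≥ 17`.

In that range the weight `log N` is inserted. Replacing it first by `log n` and then by `∑_{p ∣ n}
log p`, and replacing `f(pm)` by `f(p) f(m)`, costs `9 B² N` in all (`norm_S_mul_log_le`). What
remains is a bilinear sum over primes `p` and integers `m ≤ N/p`, split into dyadic ranges `P < p ≤
2P`.

In one range, Cauchy-Schwarz in `m` removes `f(m)`. Opening the square leaves pairs of primes `p,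
p'` weighted by a geometric sum of ratio `e((p - p')α)` (`norm_bilinear_sq_le`). Selberg's sieve
bounds the number of pairs with difference `h` by a constant times `P (log P)⁻² ∑_{d ∣ h} 1/d`
(`card_prime_pairs_mul_log_sq_le`), and the saving of `(log P)²` pays for the weights `log p log
p'`. The approximation `a/q` makes multiples of `α` well spaced modulo 1, so the geometric sums can
be added over `h`; the divisor weight costs one more logarithm (`sum_weighted_geomBound_le`).

The range thus contributes at most `B² N` times a constant multiple of `(1 + log P)/√P + L/√R + (1 +
log M)/√M`, with `M = N/P` (`norm_bilinear_le`). Over powers of two the outer terms sum to a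
constant, while the middle one occurs about `log N / log 2` times (`norm_bilinear_total_le`).
Division by `log N` gives the result, and `√L ≥ 4` absorbs the numerical loss in the middle term. -/

lemma sum_range_mul_of_coprime {m k : ℕ} (hmk : m.Coprime k) (hm : 0 < m) (hk : 0 < k)
    {u v : ℕ → ℝ} (hu : Function.Periodic u m) (hv : Function.Periodic v k) :
    ∑ n ∈ range (m * k), u n * v n = (∑ n ∈ range m, u n) * ∑ n ∈ range k, v n := by
  rw [sum_mul_sum, ← sum_product']
  refine sum_nbij' (fun n => (n % m, n % k)) (fun x => Nat.chineseRemainder hmk x.1 x.2)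
    ?_ ?_ ?_ ?_ ?_
  · intro n _
    simp [Nat.mod_lt _ hm, Nat.mod_lt _ hk]
  · rintro ⟨a, b⟩ _
    simpa using Nat.chineseRemainder_lt_mul hmk a b hm.ne' hk.ne'
  · intro n hn
    have h := Nat.chineseRemainder_modEq_unique hmk (a := n % m) (b := n % k) (z := n)
      (Nat.mod_modEq n m).symm (Nat.mod_modEq n k).symm
    have h1 := Nat.chineseRemainder_lt_mul hmk (n % m) (n % k) hm.ne' hk.ne'
    exact (Nat.ModEq.eq_of_lt_of_lt h (mem_range.1 hn) h1).symm
  · rintro ⟨a, b⟩ hab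
    simp only [mem_product, mem_range] at hab
    have h := (Nat.chineseRemainder hmk a b).2
    have h1 : (Nat.chineseRemainder hmk a b : ℕ) % m = a := by
      rw [h.1, Nat.mod_eq_of_lt hab.1]
    have h2 : (Nat.chineseRemainder hmk a b : ℕ) % k = b := by
      rw [h.2, Nat.mod_eq_of_lt hab.2]
    simp [h1, h2]
  · intro n _
    simp [hu.map_mod_nat, hv.map_mod_nat]

lemma periodic_of_dvd {u : ℕ → ℝ} {m k : ℕ} (hu : Function.Periodic u m) (h : m ∣ k) :
    Function.Periodic u k := by
  obtain ⟨c, rfl⟩ := h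
  rw [mul_comm]
  exact hu.nat_mul c

lemma periodic_prod {s : Finset ℕ} {u : ℕ → ℕ → ℝ} (hu : ∀ p ∈ s, Function.Periodic (u p) p) :
    Function.Periodic (fun n => ∏ p ∈ s, u p n) (∏ p ∈ s, p) := by
  intro n
  exact prod_congr rfl fun p hp => periodic_of_dvd (hu p hp) (dvd_prod_of_mem _ hp) n

lemma sum_range_prod_of_primes {s : Finset ℕ} (hs : ∀ p ∈ s, p.Prime) {u : ℕ → ℕ → ℝ}
    (hu : ∀ p ∈ s, Function.Periodic (u p) p) :
    ∑ n ∈ range (∏ p ∈ s, p), ∏ p ∈ s, u p n = ∏ p ∈ s, ∑ n ∈ range p, u p n := by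
  induction s using Finset.induction_on with
  | empty => simp
  | insert p s hp ih =>
    have hs' : ∀ r ∈ s, r.Prime := fun r hr => hs r (mem_insert_of_mem hr)
    have hu' : ∀ r ∈ s, Function.Periodic (u r) r := fun r hr => hu r (mem_insert_of_mem hr)
    have hpp := hs p (mem_insert_self _ _)
    rw [prod_insert hp, prod_insert hp, ← ih hs' hu', ← sum_range_mul_of_coprime _ hpp.pos
      (prod_pos fun r hr => (hs' r hr).pos) (hu p (mem_insert_self _ _)) (periodic_prod hu')]
    · exact sum_congr rfl fun n _ => prod_insert hp
    · refine Nat.Coprime.prod_right fun r hr => (Nat.coprime_primes hpp (hs' r hr)).2 ?_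
      rintro rfl
      exact hp hr

lemma sum_range_periodic_shift {v : ℕ → ℝ} {D : ℕ} (hv : Function.Periodic v D) (a : ℕ) :
    ∑ i ∈ range D, v (a + i) = ∑ i ∈ range D, v i := by
  induction a with
  | zero => simp
  | succ a ih =>
    rw [← ih]
    have h1 := sum_range_succ' (fun i => v (a + i)) D
    have h2 := sum_range_succ (fun i => v (a + i)) D
    have h3 : v (a + D) = v (a + 0) := hv a
    have h4 : ∑ i ∈ range D, v (a + 1 + i) = ∑ i ∈ range D, v (a + (i + 1)) :=
      sum_congr rfl fun i _ => by congr 1; ring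
    linarith

/-- Complete periods contribute their common sum, and fewer than `D` terms, each at most `c`, are
left over. The sum over a period must be nonnegative because `⌊P/D⌋` is replaced by the larger
`P/D`. -/
lemma sum_Ioc_periodic_le {v : ℕ → ℝ} {D : ℕ} (hD : 0 < D) (hv : Function.Periodic v D) {c : ℝ}
    (hc : ∀ n, v n ≤ c) (hc0 : 0 ≤ c) (hS : 0 ≤ ∑ i ∈ range D, v i) (a P : ℕ) :
    ∑ n ∈ Ioc a (a + P), v n ≤ P * ((∑ i ∈ range D, v i) / D) + c * D := by
  have h0 : ∑ n ∈ Ioc a (a + P), v n = ∑ i ∈ range P, v (a + 1 + i) := by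
    rw [show Ioc a (a + P) = Ico (a + 1) (a + 1 + P) by ext; simp; omega, sum_Ico_eq_sum_range]
    simp
  have h1 : ∀ k b, ∑ i ∈ range (D * k), v (b + i) = k * ∑ i ∈ range D, v i := by
    intro k b
    induction k with
    | zero => simp
    | succ k ih =>
      rw [Nat.mul_succ, sum_range_add, ih]
      have : ∑ x ∈ range D, v (b + (D * k + x)) = ∑ i ∈ range D, v i := by
        rw [← sum_range_periodic_shift hv (b + D * k)]
        exact sum_congr rfl fun i _ => by congr 1; ring
      rw [this]
      push_cast
      ring
  have hD' : (0 : ℝ) < D := by exact_mod_cast hD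
  rw [h0, ← Nat.div_add_mod P D, sum_range_add, h1]
  have h2 : ∑ x ∈ range (P % D), v (a + 1 + (D * (P / D) + x)) ≤ c * D := by
    calc _ ≤ ∑ x ∈ range (P % D), c := sum_le_sum fun _ _ => hc _
      _ = (P % D : ℕ) * c := by simp
      _ ≤ D * c := by
          gcongr
          exact (Nat.mod_lt _ hD).le
      _ = c * D := mul_comm _ _
  rw [Nat.div_add_mod P D]
  have h3 : ((P / D : ℕ) : ℝ) * ∑ i ∈ range D, v i ≤ P * ((∑ i ∈ range D, v i) / D) := by
    rw [mul_div_assoc', mul_comm (P : ℝ), mul_div_assoc, mul_comm]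
    gcongr
    exact Nat.cast_div_le
  linarith

/-! ### The orthogonal form of Selberg's sieve for `n (n + h)` -/

/-- The number of residues `n` modulo `p` with `p ∣ n (n + h)`. -/
noncomputable def sieveWeight (h p : ℕ) : ℝ := if p ∣ h then 1 else 2

/-- The local density quotient `ω(p) / (p - ω(p))`. -/
noncomputable def sieveDensity (h p : ℕ) : ℝ := sieveWeight h p / (p - sieveWeight h p)

/-- A function of mean zero modulo `p`, constant on the residues that survive the sieve. -/
noncomputable def sieveLocal (h p n : ℕ) : ℝ :=
  if p ∣ n * (n + h) then -1 else sieveDensity h p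

lemma sieveWeight_pos (h p : ℕ) : 0 < sieveWeight h p := by
  unfold sieveWeight; split_ifs <;> norm_num

lemma sieveWeight_lt {h p : ℕ} (hp : p.Prime) (hh : 2 ∣ h) : sieveWeight h p < p := by
  unfold sieveWeight
  split_ifs with h1
  · exact_mod_cast hp.one_lt
  · have : p ≠ 2 := by rintro rfl; exact h1 hh
    have := hp.two_le
    exact_mod_cast (by omega : 2 < p)

lemma sieveDensity_pos {h p : ℕ} (hp : p.Prime) (hh : 2 ∣ h) : 0 < sieveDensity h p :=
  div_pos (sieveWeight_pos h p) (sub_pos.2 (sieveWeight_lt hp hh))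

lemma card_filter_dvd_mul_add {h p : ℕ} (hp : p.Prime) :
    (#{n ∈ range p | p ∣ n * (n + h)} : ℝ) = sieveWeight h p := by
  unfold sieveWeight
  have key : ∀ n ∈ range p, (p ∣ n * (n + h) ↔ n = 0 ∨ p ∣ n + h) := by
    intro n hn
    rw [hp.dvd_mul]
    refine or_congr_left ⟨fun h1 => ?_, fun h1 => by simp [h1]⟩
    exact Nat.eq_zero_of_dvd_of_lt h1 (mem_range.1 hn)
  rw [filter_congr key]
  split_ifs with h1
  · have : {n ∈ range p | n = 0 ∨ p ∣ n + h} = {0} := by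
      ext n
      simp only [mem_filter, mem_range, mem_singleton]
      constructor
      · rintro ⟨h2, h3 | h3⟩
        · exact h3
        · exact Nat.eq_zero_of_dvd_of_lt ((Nat.dvd_add_left h1).1 h3) h2
      · rintro rfl
        exact ⟨hp.pos, Or.inl rfl⟩
    simp [this]
  · have h2 : h % p ≠ 0 := fun h3 => h1 (Nat.dvd_of_mod_eq_zero h3)
    have h3 := Nat.mod_lt h hp.pos
    have : {n ∈ range p | n = 0 ∨ p ∣ n + h} = {0, p - h % p} := by
      ext n
      simp only [mem_filter, mem_range, mem_singleton, mem_insert]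
      have h4 : p ∣ n + h ↔ p ∣ n + h % p := by
        rw [Nat.dvd_iff_mod_eq_zero, Nat.dvd_iff_mod_eq_zero]; simp [Nat.add_mod]
      rw [h4]
      constructor
      · rintro ⟨h5, h6 | h6⟩
        · exact Or.inl h6
        · right
          obtain ⟨c, hc⟩ := h6
          have : c < 2 := by
            by_contra hc2
            have : p * 2 ≤ p * c := Nat.mul_le_mul_left _ (by omega)
            omega
          interval_cases c <;> omega
      · rintro (rfl | rfl)
        · exact ⟨hp.pos, Or.inl rfl⟩
        · refine ⟨by omega, Or.inr ?_⟩
          rw [Nat.sub_add_cancel h3.le]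
    rw [this, card_pair (by omega)]
    norm_num

lemma sum_range_ite_dvd {h p : ℕ} (hp : p.Prime) (A C : ℝ) :
    ∑ n ∈ range p, (if p ∣ n * (n + h) then A else C)
      = sieveWeight h p * A + (p - sieveWeight h p) * C := by
  have h1 := card_filter_dvd_mul_add (h := h) hp
  have h2 := card_filter_add_card_filter_not (s := range p) (fun n => p ∣ n * (n + h))
  rw [card_range] at h2
  have h3 : (#{n ∈ range p | ¬ p ∣ n * (n + h)} : ℝ) = p - sieveWeight h p := by
    have h4 : (#{n ∈ range p | p ∣ n * (n + h)} : ℝ) + #{n ∈ range p | ¬ p ∣ n * (n + h)} = p := by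
      exact_mod_cast h2
    linarith
  rw [sum_ite, sum_const, sum_const, nsmul_eq_mul, nsmul_eq_mul, h1, h3]

lemma sum_sieveLocal {h p : ℕ} (hp : p.Prime) (hh : 2 ∣ h) :
    ∑ n ∈ range p, sieveLocal h p n = 0 := by
  unfold sieveLocal
  rw [sum_range_ite_dvd hp]
  have := sub_pos.2 (sieveWeight_lt hp hh)
  unfold sieveDensity
  field_simp
  ring

lemma sum_sieveLocal_sq {h p : ℕ} (hp : p.Prime) (hh : 2 ∣ h) :
    ∑ n ∈ range p, sieveLocal h p n * sieveLocal h p n = p * sieveDensity h p := by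
  have h1 : ∀ n, sieveLocal h p n * sieveLocal h p n
      = if p ∣ n * (n + h) then 1 else sieveDensity h p * sieveDensity h p := by
    intro n; unfold sieveLocal; split_ifs <;> ring
  simp_rw [h1]
  rw [sum_range_ite_dvd hp]
  have := sub_pos.2 (sieveWeight_lt hp hh)
  unfold sieveDensity
  field_simp
  ring

lemma periodic_sieveLocal (h p : ℕ) : Function.Periodic (sieveLocal h p) p := by
  intro n
  unfold sieveLocal
  have : p ∣ (n + p) * (n + p + h) ↔ p ∣ n * (n + h) := by
    have : (n + p) * (n + p + h) = n * (n + h) + p * (n + (n + p + h)) := by ring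
    rw [this]
    exact (Nat.dvd_add_iff_left (dvd_mul_right _ _)).symm
  simp [this]

/-- The density `ω/(p - ω)` exceeds 1 only for `p = 3` with `ω = 2`. Products over distinct primes
therefore stay bounded by 2 whatever the number of factors. -/
lemma abs_sieveLocal_le {h p : ℕ} (hp : p.Prime) (hh : 2 ∣ h) (n : ℕ) :
    |sieveLocal h p n| ≤ if p = 3 then 2 else 1 := by
  unfold sieveLocal
  split_ifs with h1 h2 h2
  · norm_num
  · norm_num
  all_goals rw [abs_of_pos (sieveDensity_pos hp hh)]
  · subst h2
    unfold sieveDensity sieveWeight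
    split_ifs <;> norm_num
  · have hlt := sieveWeight_lt hp hh
    unfold sieveDensity
    rw [div_le_one (by linarith)]
    unfold sieveWeight at *
    split_ifs at * with h3
    · have : (2 : ℝ) ≤ p := by exact_mod_cast hp.two_le
      linarith
    · have h4 : 2 < p := by exact_mod_cast hlt
      have h5 : p ≠ 4 := by rintro rfl; revert hp; decide
      have : (4 : ℝ) ≤ p := by exact_mod_cast (by omega : 4 ≤ p)
      linarith

/-- The multiplicative extension of `sieveLocal`. -/
noncomputable def sieveChar (h d n : ℕ) : ℝ := ∏ p ∈ d.primeFactors, sieveLocal h p n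

/-- The multiplicative extension of `sieveDensity`. -/
noncomputable def sieveMass (h d : ℕ) : ℝ := ∏ p ∈ d.primeFactors, sieveDensity h p

lemma sieveMass_pos {h : ℕ} (hh : 2 ∣ h) (d : ℕ) : 0 < sieveMass h d :=
  prod_pos fun _ hp => sieveDensity_pos (Nat.prime_of_mem_primeFactors hp) hh

lemma abs_sieveChar_le {h : ℕ} (hh : 2 ∣ h) (d n : ℕ) : |sieveChar h d n| ≤ 2 := by
  unfold sieveChar
  rw [abs_prod]
  calc _ ≤ ∏ p ∈ d.primeFactors, (if p = 3 then (2 : ℝ) else 1) :=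
        prod_le_prod (fun _ _ => abs_nonneg _)
          fun p hp => abs_sieveLocal_le (Nat.prime_of_mem_primeFactors hp) hh n
    _ ≤ 2 := by
        rw [prod_ite_eq']
        split_ifs <;> norm_num

/-- Near-orthogonality. By the Chinese remainder theorem the sum over a full period factors over
primes; if `d ≠ d'`, a prime dividing exactly one of them contributes a local mean of zero. The
incomplete period costs at most `4 · lcm(d, d')`. -/
lemma sum_sieveChar_mul_le {h : ℕ} (hh : 2 ∣ h) {d d' : ℕ} (hd : Squarefree d)
    (hd' : Squarefree d') (a P : ℕ) :
    ∑ n ∈ Ioc a (a + P), sieveChar h d n * sieveChar h d' n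
      ≤ P * (if d = d' then sieveMass h d else 0) + 4 * (d * d') := by
  classical
  set s := d.primeFactors with hs
  set t := d'.primeFactors with ht
  have hpr : ∀ p ∈ s ∪ t, p.Prime := by
    intro p hp
    rcases mem_union.1 hp with hp | hp <;> exact Nat.prime_of_mem_primeFactors hp
  set u : ℕ → ℕ → ℝ := fun p n =>
    (if p ∈ s then sieveLocal h p n else 1) * (if p ∈ t then sieveLocal h p n else 1) with hu
  have hup : ∀ p ∈ s ∪ t, Function.Periodic (u p) p := by
    intro p _ n
    simp only [hu, periodic_sieveLocal h p n]
  have hprod : ∀ n, sieveChar h d n * sieveChar h d' n = ∏ p ∈ s ∪ t, u p n := by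
    intro n
    simp only [hu, prod_mul_distrib, prod_ite_mem, sieveChar]
    congr 2 <;> simp [← hs, ← ht]
  set D := ∏ p ∈ s ∪ t, p with hD
  have hD0 : 0 < D := prod_pos fun p hp => (hpr p hp).pos
  have hDle : D ≤ d * d' := by
    have h1 : (∏ p ∈ s ∪ t, p) * ∏ p ∈ s ∩ t, p = (∏ p ∈ s, p) * ∏ p ∈ t, p :=
      prod_union_inter
    rw [Nat.prod_primeFactors_of_squarefree hd, Nat.prod_primeFactors_of_squarefree hd'] at h1
    rw [← h1]
    exact Nat.le_mul_of_pos_right _ (prod_pos fun p hp =>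
      (hpr p (mem_union_left _ (mem_inter.1 hp).1)).pos)
  have hsum : ∑ n ∈ range D, ∏ p ∈ s ∪ t, u p n = if d = d' then D * sieveMass h d else 0 := by
    rw [hD, sum_range_prod_of_primes hpr hup]
    split_ifs with hdd
    · subst hdd
      have hst : s ∪ t = s := by rw [hs, ht, union_self]
      rw [hst]
      push_cast
      unfold sieveMass
      rw [← prod_mul_distrib]
      refine prod_congr rfl fun p hp => ?_
      rw [← sum_sieveLocal_sq (Nat.prime_of_mem_primeFactors hp) hh]
      refine sum_congr rfl fun n _ => ?_
      have hp' : p ∈ t := hp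
      simp [hu, hp, hp']
    · have hne : s ≠ t := by
        intro hst
        apply hdd
        rw [← Nat.prod_primeFactors_of_squarefree hd, ← Nat.prod_primeFactors_of_squarefree hd',
          ← hs, ← ht, hst]
      have : ∃ p ∈ s ∪ t, ¬ (p ∈ s ↔ p ∈ t) := by
        by_contra hcon
        push Not at hcon
        apply hne
        ext p
        by_cases hp : p ∈ s ∪ t
        · exact hcon p hp
        · simp only [mem_union, not_or] at hp
          simp [hp.1, hp.2]
      obtain ⟨p, hp, hpst⟩ := this
      refine prod_eq_zero hp ?_
      rw [← sum_sieveLocal (hpr p hp) hh]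
      refine sum_congr rfl fun n _ => ?_
      simp only [hu]
      by_cases h1 : p ∈ s
      · have h2 : p ∉ t := fun h2 => hpst ⟨fun _ => h2, fun _ => h1⟩
        rw [if_pos h1, if_neg h2, mul_one]
      · have h2 : p ∈ t := (mem_union.1 hp).resolve_left h1
        rw [if_neg h1, if_pos h2, one_mul]
  have hbd : ∀ n, ∏ p ∈ s ∪ t, u p n ≤ 4 := by
    intro n
    rw [← hprod]
    refine (le_abs_self _).trans ?_
    rw [abs_mul]
    have h1 := abs_sieveChar_le hh d n
    have h2 := abs_sieveChar_le hh d' n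
    nlinarith [abs_nonneg (sieveChar h d n), abs_nonneg (sieveChar h d' n)]
  have hD' : (0 : ℝ) < D := by exact_mod_cast hD0
  have hnn : 0 ≤ ∑ n ∈ range D, ∏ p ∈ s ∪ t, u p n := by
    rw [hsum]
    split_ifs
    · have := sieveMass_pos hh d
      positivity
    · exact le_rfl
  have := sum_Ioc_periodic_le hD0 (periodic_prod hup) hbd (by norm_num) hnn a P
  simp_rw [hprod]
  refine this.trans ?_
  rw [hsum]
  have h5 : (if d = d' then D * sieveMass h d else 0) / (D : ℝ)
      = if d = d' then sieveMass h d else 0 := by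
    split_ifs
    · field_simp
    · simp
  rw [h5]
  have : (D : ℝ) ≤ d * d' := by exact_mod_cast hDle
  linarith

/-- The sum over square-free `d ≤ Q` of the sieve densities. -/
noncomputable def sieveTotal (h Q : ℕ) : ℝ := ∑ d ∈ Icc 1 Q with Squarefree d, sieveMass h d

/-- Selberg's upper bound for the number of `n` in an interval such that `n (n + h)` has no prime
factor up to `Q`. -/
lemma card_sifted_mul_sieveTotal_le {h : ℕ} (hh : 2 ∣ h) (Q a P : ℕ) (hQ : 1 ≤ Q) (A : Finset ℕ)
    (hA : A ⊆ Ioc a (a + P))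
    (hsift : ∀ n ∈ A, ∀ p, p.Prime → p ≤ Q → ¬ p ∣ n * (n + h)) :
    #A * sieveTotal h Q ≤ P + 4 * (Q : ℝ) ^ 4 := by
  set T := {d ∈ Icc 1 Q | Squarefree d} with hT
  have hLeq : sieveTotal h Q = ∑ d ∈ T, sieveMass h d := rfl
  set L := sieveTotal h Q with hL
  have h1T : 1 ∈ T := by simp [hT, hQ]
  have hL1 : 1 ≤ L := by
    have : sieveMass h 1 ≤ L := by
      rw [hLeq]
      exact single_le_sum (f := sieveMass h) (fun d _ => (sieveMass_pos hh d).le) h1T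
    simpa [sieveMass] using this
  -- On sifted `n` every local factor takes its surviving value, so `sieveChar` reduces to
  -- `sieveMass`. Comparing the second moment over `A` with that over the whole interval gives the
  -- sieve bound.
  have hF : ∀ n ∈ A, ∑ d ∈ T, sieveChar h d n = L := by
    intro n hn
    rw [hLeq]
    refine sum_congr rfl fun d hd => prod_congr rfl fun p hp => ?_
    have hdT := (mem_filter.1 hd)
    have hd1 := mem_Icc.1 hdT.1
    have := hsift n hn p (Nat.prime_of_mem_primeFactors hp)
      ((Nat.le_of_mem_primeFactors hp).trans hd1.2)
    simp [sieveLocal, this]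
  have hlow : #A * L ^ 2 ≤ ∑ n ∈ Ioc a (a + P), (∑ d ∈ T, sieveChar h d n) ^ 2 := by
    calc #A * L ^ 2 = ∑ n ∈ A, (∑ d ∈ T, sieveChar h d n) ^ 2 := by
          rw [sum_congr rfl fun n hn => by rw [hF n hn]]
          simp
      _ ≤ _ := sum_le_sum_of_subset_of_nonneg hA fun _ _ _ => sq_nonneg _
  have hup : ∑ n ∈ Ioc a (a + P), (∑ d ∈ T, sieveChar h d n) ^ 2 ≤ P * L + 4 * (Q : ℝ) ^ 4 := by
    have : ∀ n, (∑ d ∈ T, sieveChar h d n) ^ 2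
        = ∑ d ∈ T, ∑ d' ∈ T, sieveChar h d n * sieveChar h d' n := by
      intro n; rw [sq, sum_mul_sum]
    simp_rw [this]
    rw [sum_comm]
    calc _ = ∑ d ∈ T, ∑ d' ∈ T, ∑ n ∈ Ioc a (a + P), sieveChar h d n * sieveChar h d' n := by
          exact sum_congr rfl fun d _ => sum_comm
      _ ≤ ∑ d ∈ T, ∑ d' ∈ T,
            (P * (if d = d' then sieveMass h d else 0) + 4 * ((Q : ℝ) * Q)) := by
          refine sum_le_sum fun d hd => sum_le_sum fun d' hd' => ?_
          have h1 := mem_filter.1 hd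
          have h2 := mem_filter.1 hd'
          refine (sum_sieveChar_mul_le hh h1.2 h2.2 a P).trans ?_
          have h3 : (d : ℝ) ≤ Q := by exact_mod_cast (mem_Icc.1 h1.1).2
          have h4 : (d' : ℝ) ≤ Q := by exact_mod_cast (mem_Icc.1 h2.1).2
          gcongr
      _ = P * L + #T * (#T * (4 * ((Q : ℝ) * Q))) := by
          simp_rw [sum_add_distrib, sum_const, nsmul_eq_mul, ← mul_sum, sum_ite_eq]
          rw [hLeq]
          congr 2
          exact sum_congr rfl fun d hd => if_pos hd
      _ ≤ P * L + Q * (Q * (4 * ((Q : ℝ) * Q))) := by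
          have : (#T : ℝ) ≤ Q := by
            have h1 : #T ≤ #(Icc 1 Q) := card_filter_le _ _
            rw [Nat.card_Icc] at h1
            exact_mod_cast (by omega : #T ≤ Q)
          gcongr
      _ = _ := by ring
  -- Because `L ≥ 1`, the error term may also be multiplied by `L`, and then one factor `L` cancels.
  have h3 : #A * L * L ≤ (P + 4 * (Q : ℝ) ^ 4) * L := by
    nlinarith [hlow.trans hup, pow_nonneg (Nat.cast_nonneg (α := ℝ) Q) 4]
  exact le_of_mul_le_mul_right h3 (by linarith)

/-! ### The lower bound for the sieve total -/

/-- A choice of witnesses is automatically injective, since `g` recovers `n` from its witness. This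
compares sums when each term has some factorization, with no need for a canonical one. -/
lemma sum_le_sum_of_exists {ι κ : Type*} [DecidableEq κ] {S : Finset ι} {X : Finset κ} (g : κ → ι)
    {F : ι → ℝ} {G : κ → ℝ} (hG : ∀ x ∈ X, 0 ≤ G x)
    (h : ∀ n ∈ S, ∃ x ∈ X, g x = n ∧ F n ≤ G x) : ∑ n ∈ S, F n ≤ ∑ x ∈ X, G x := by
  rcases S.eq_empty_or_nonempty with rfl | hS
  · simpa using sum_nonneg hG
  obtain ⟨n₀, hn₀⟩ := hS
  obtain ⟨x₀, -, -, -⟩ := h n₀ hn₀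
  have h' : ∀ n, ∃ x, n ∈ S → x ∈ X ∧ g x = n ∧ F n ≤ G x := by
    intro n
    by_cases hn : n ∈ S
    · obtain ⟨x, hx⟩ := h n hn
      exact ⟨x, fun _ => hx⟩
    · exact ⟨x₀, fun h => absurd h hn⟩
  choose c hc using h'
  calc ∑ n ∈ S, F n ≤ ∑ n ∈ S, G (c n) := sum_le_sum fun n hn => (hc n hn).2.2
    _ = ∑ x ∈ S.image c, G x := by
        rw [sum_image]
        intro a ha b hb hab
        rw [← (hc a ha).2.1, ← (hc b hb).2.1, hab]
    _ ≤ _ := by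
        refine sum_le_sum_of_subset_of_nonneg ?_ fun x hx _ => hG x hx
        intro x hx
        obtain ⟨n, hn, rfl⟩ := mem_image.1 hx
        exact (hc n hn).1

/-- The completely multiplicative function with value `ω(p) / p` at `p`. -/
noncomputable def sieveRatio (h : ℕ) : ℕ →* ℝ where
  toFun n := if n = 0 then 0 else (n.primeFactorsList.map fun p => sieveWeight h p / p).prod
  map_one' := by simp
  map_mul' m n := by
    rcases eq_or_ne m 0 with rfl | hm
    · simp
    rcases eq_or_ne n 0 with rfl | hn
    · simp
    rw [if_neg (mul_ne_zero hm hn), if_neg hm, if_neg hn,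
      ((Nat.perm_primeFactorsList_mul hm hn).map _).prod_eq, List.map_append, List.prod_append]

lemma sieveRatio_prime {h p : ℕ} (hp : p.Prime) : sieveRatio h p = sieveWeight h p / p := by
  change (if p = 0 then _ else _) = _
  rw [if_neg hp.ne_zero, Nat.primeFactorsList_prime hp]
  simp

lemma sieveRatio_nonneg (h n : ℕ) : 0 ≤ sieveRatio h n := by
  change 0 ≤ if n = 0 then (0 : ℝ) else _
  split_ifs
  · exact le_rfl
  · refine List.prod_nonneg fun x hx => ?_
    obtain ⟨p, -, rfl⟩ := List.mem_map.1 hx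
    exact div_nonneg (sieveWeight_pos h p).le (Nat.cast_nonneg p)

lemma sieveRatio_prime_lt_one {h p : ℕ} (hh : 2 ∣ h) (hp : p.Prime) : sieveRatio h p < 1 := by
  rw [sieveRatio_prime hp, div_lt_one (by exact_mod_cast hp.pos)]
  exact sieveWeight_lt hp hh

/-- Each such `n` is `d m` with `m` composed of primes of `d`. Summing over all such `m` gives an
Euler product, and `(ω/p)(1 - ω/p)⁻¹ = ω/(p - ω)`. -/
lemma sum_sieveRatio_of_radical_le {h : ℕ} (hh : 2 ∣ h) {d : ℕ} (hd : Squarefree d) (Q : ℕ) :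
    ∑ n ∈ Icc 1 Q with ∏ p ∈ n.primeFactors, p = d, sieveRatio h n ≤ sieveMass h d := by
  set T := {n ∈ Icc 1 Q | ∏ p ∈ n.primeFactors, p = d} with hT
  have hd0 : d ≠ 0 := hd.ne_zero
  have hdvd : ∀ n ∈ T, d ∣ n ∧ n ≠ 0 ∧ n.primeFactors = d.primeFactors := by
    intro n hn
    have h1 := mem_filter.1 hn
    have h2 := mem_Icc.1 h1.1
    refine ⟨h1.2 ▸ Nat.prod_primeFactors_dvd n, by omega, ?_⟩
    rw [← h1.2, Nat.primeFactors_prod fun p hp => Nat.prime_of_mem_primeFactors hp]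
  have hE := (EulerProduct.summable_and_hasSum_factoredNumbers_prod_filter_prime_geometric
    (f := sieveRatio h) (fun {p} hp => by
      rw [Real.norm_of_nonneg (sieveRatio_nonneg h p)]
      exact sieveRatio_prime_lt_one hh hp) d.primeFactors).2
  have hE' := (hasSum_subtype_iff_indicator (f := fun m => sieveRatio h m)).1 hE
  have hfilter : {p ∈ d.primeFactors | p.Prime} = d.primeFactors :=
    filter_true_of_mem fun p hp => Nat.prime_of_mem_primeFactors hp
  rw [hfilter] at hE'
  have hle : ∑ m ∈ T.image (· / d), sieveRatio h m
      ≤ ∏ p ∈ d.primeFactors, (1 - sieveRatio h p)⁻¹ := by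
    refine le_trans (le_of_eq ?_) (sum_le_hasSum (T.image (· / d)) (fun m _ => ?_) hE')
    · refine sum_congr rfl fun m hm => (Set.indicator_of_mem ?_ _).symm
      obtain ⟨n, hn, rfl⟩ := mem_image.1 hm
      obtain ⟨h1, h2, h3⟩ := hdvd n hn
      rw [Nat.mem_factoredNumbers]
      have h4 : n / d ≠ 0 := (Nat.div_pos (Nat.le_of_dvd (Nat.pos_of_ne_zero h2) h1)
        (Nat.pos_of_ne_zero hd0)).ne'
      refine ⟨h4, fun p hp => ?_⟩
      rw [← h3]
      exact Nat.primeFactors_mono (Nat.div_dvd_of_dvd h1) h2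
        (Nat.mem_primeFactors_iff_mem_primeFactorsList.2 hp)
    · exact Set.indicator_nonneg (fun m _ => sieveRatio_nonneg h m) m
  have hinj : Set.InjOn (· / d) (T : Set ℕ) := by
    intro a ha b hb hab
    obtain ⟨h1, -, -⟩ := hdvd a ha
    obtain ⟨h2, -, -⟩ := hdvd b hb
    simp only at hab
    rw [← Nat.div_mul_cancel h1, ← Nat.div_mul_cancel h2, hab]
  rw [sum_image hinj] at hle
  have hd1 : sieveRatio h d = ∏ p ∈ d.primeFactors, sieveRatio h p := by
    conv_lhs => rw [← Nat.prod_primeFactors_of_squarefree hd]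
    exact map_prod _ _ _
  calc ∑ n ∈ T, sieveRatio h n = sieveRatio h d * ∑ n ∈ T, sieveRatio h (n / d) := by
        rw [mul_sum]
        refine sum_congr rfl fun n hn => ?_
        rw [← map_mul, Nat.mul_div_cancel' (hdvd n hn).1]
    _ ≤ sieveRatio h d * ∏ p ∈ d.primeFactors, (1 - sieveRatio h p)⁻¹ :=
        mul_le_mul_of_nonneg_left hle (sieveRatio_nonneg h d)
    _ = sieveMass h d := by
        rw [hd1, ← prod_mul_distrib]
        refine prod_congr rfl fun p hp => ?_
        have hp' := Nat.prime_of_mem_primeFactors hp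
        have h1 := sub_pos.2 (sieveWeight_lt hp' hh)
        have h2 : (0 : ℝ) < p := by exact_mod_cast hp'.pos
        rw [sieveRatio_prime hp', sieveDensity, one_sub_div h2.ne']
        field_simp

lemma sum_sieveRatio_le_sieveTotal {h : ℕ} (hh : 2 ∣ h) (Q : ℕ) :
    ∑ n ∈ Icc 1 Q, sieveRatio h n ≤ sieveTotal h Q := by
  have hmaps : ∀ n ∈ Icc 1 Q, ∏ p ∈ n.primeFactors, p ∈ {d ∈ Icc 1 Q | Squarefree d} := by
    intro n hn
    have hn' := mem_Icc.1 hn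
    have h1 : ∏ p ∈ n.primeFactors, p ∣ n := Nat.prod_primeFactors_dvd n
    have h2 : 0 < ∏ p ∈ n.primeFactors, p :=
      prod_pos fun p hp => (Nat.prime_of_mem_primeFactors hp).pos
    refine mem_filter.2 ⟨mem_Icc.2 ⟨h2, (Nat.le_of_dvd (by omega) h1).trans hn'.2⟩, ?_⟩
    rw [← Nat.radical_eq_prod_primeFactors]
    exact UniqueFactorizationMonoid.squarefree_radical
  rw [← sum_fiberwise_of_maps_to hmaps]
  exact sum_le_sum fun d hd => sum_sieveRatio_of_radical_le hh (mem_filter.1 hd).2 Q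

/-- Multiplying `n` by `p` at most doubles the set of divisors prime to `h`, and does not enlarge it
when `p ∣ h`. These are exactly the factors `sieveWeight h p` by which the right side grows. -/
lemma card_coprime_divisors_le (h n : ℕ) :
    (#{b ∈ n.divisors | b.Coprime h} : ℝ) ≤ n * sieveRatio h n := by
  induction n using induction_on_primes with
  | zero => simp
  | one => simpa using card_filter_le {1} fun b : ℕ => b.Coprime h
  | prime_mul p n hp ih =>
    have hp0 : (0 : ℝ) < p := by exact_mod_cast hp.pos
    have hrw : ((p * n : ℕ) : ℝ) * sieveRatio h (p * n)
        = sieveWeight h p * (n * sieveRatio h n) := by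
      rw [map_mul, sieveRatio_prime hp]
      push_cast
      field_simp
    rw [hrw]
    set D := {b ∈ n.divisors | b.Coprime h} with hD
    by_cases hph : p ∣ h
    · have : {b ∈ (p * n).divisors | b.Coprime h} ⊆ D := by
        intro b hb
        obtain ⟨h1, h2⟩ := mem_filter.1 hb
        obtain ⟨h3, h4⟩ := Nat.mem_divisors.1 h1
        refine mem_filter.2 ⟨Nat.mem_divisors.2 ⟨?_, fun h => h4 (by simp [h])⟩, h2⟩
        exact Nat.Coprime.dvd_of_dvd_mul_left (Nat.Coprime.coprime_dvd_right hph h2) h3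
      have h5 : (#{b ∈ (p * n).divisors | b.Coprime h} : ℝ) ≤ #D := by
        exact_mod_cast card_le_card this
      rw [sieveWeight, if_pos hph, one_mul]
      exact h5.trans ih
    · have : {b ∈ (p * n).divisors | b.Coprime h} ⊆ D ∪ D.image (fun c => p * c) := by
        intro b hb
        obtain ⟨h1, h2⟩ := mem_filter.1 hb
        obtain ⟨h3, h4⟩ := Nat.mem_divisors.1 h1
        have hn0 : n ≠ 0 := fun h => h4 (by simp [h])
        by_cases hpb : p ∣ b
        · obtain ⟨c, rfl⟩ := hpb
          refine mem_union_right _ (mem_image.2 ⟨c, mem_filter.2 ⟨Nat.mem_divisors.2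
            ⟨Nat.dvd_of_mul_dvd_mul_left hp.pos h3, hn0⟩, Nat.Coprime.coprime_mul_left h2⟩, rfl⟩)
        · refine mem_union_left _ (mem_filter.2 ⟨Nat.mem_divisors.2 ⟨?_, hn0⟩, h2⟩)
          exact Nat.Coprime.dvd_of_dvd_mul_left ((Nat.Prime.coprime_iff_not_dvd hp).2 hpb).symm h3
      have h5 : #{b ∈ (p * n).divisors | b.Coprime h} ≤ #D + #D :=
        (card_le_card this).trans ((card_union_le _ _).trans (add_le_add_right card_image_le _))
      have h6 : (#{b ∈ (p * n).divisors | b.Coprime h} : ℝ) ≤ #D + #D := by exact_mod_cast h5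
      rw [sieveWeight, if_neg hph]
      linarith

/-- Grouping the pairs by their product `n = ab`, the value `1/n` occurs at most as often as `n` has
divisors `b` prime to `h`. -/
lemma harmonic_mul_coprime_le_sum_sieveRatio (h y : ℕ) :
    (∑ a ∈ Icc 1 y, (1 : ℝ) / a) * (∑ b ∈ Icc 1 y with b.Coprime h, (1 : ℝ) / b)
      ≤ ∑ n ∈ Icc 1 (y ^ 2), sieveRatio h n := by
  set C := {b ∈ Icc 1 y | b.Coprime h} with hC
  rw [sum_mul_sum, ← sum_product']
  have hmaps : ∀ x ∈ Icc 1 y ×ˢ C, x.1 * x.2 ∈ Icc 1 (y ^ 2) := by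
    rintro ⟨a, b⟩ hx
    simp only [mem_product, hC, mem_filter, mem_Icc] at hx ⊢
    obtain ⟨⟨h1, h2⟩, ⟨h3, h4⟩, -⟩ := hx
    exact ⟨Nat.mul_pos h1 h3, by rw [sq]; exact Nat.mul_le_mul h2 h4⟩
  rw [← sum_fiberwise_of_maps_to hmaps]
  refine sum_le_sum fun n hn => ?_
  have hn1 : 1 ≤ n := (mem_Icc.1 hn).1
  have hn0 : (0 : ℝ) < n := by exact_mod_cast hn1
  set X := {x ∈ Icc 1 y ×ˢ C | x.1 * x.2 = n} with hX
  have hcard : #X ≤ #{b ∈ n.divisors | b.Coprime h} := by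
    refine card_le_card_of_injOn Prod.snd ?_ ?_
    · rintro ⟨a, b⟩ hx
      simp only [hX, hC, coe_filter, Set.mem_ofPred_eq, mem_product, mem_filter] at hx ⊢
      exact ⟨Nat.mem_divisors.2 ⟨Dvd.intro_left a hx.2, by omega⟩, hx.1.2.2⟩
    · rintro ⟨a, b⟩ hx ⟨a', b'⟩ hx' hbb
      simp only [hX, hC, coe_filter, Set.mem_ofPred_eq, mem_product, mem_filter, mem_Icc] at hx hx'
      simp only at hbb
      subst hbb
      have : a = a' := Nat.eq_of_mul_eq_mul_right hx.1.2.1.1 (hx.2.trans hx'.2.symm)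
      rw [this]
  calc ∑ x ∈ X, (1 : ℝ) / x.1 * (1 / x.2) = ∑ x ∈ X, (1 : ℝ) / n := by
        refine sum_congr rfl fun x hx => ?_
        rw [← (mem_filter.1 hx).2]
        push_cast
        rw [one_div_mul_one_div]
    _ = #X * (1 / n) := by rw [sum_const, nsmul_eq_mul]
    _ ≤ n * sieveRatio h n * (1 / n) := by
        gcongr
        exact le_trans (by exact_mod_cast hcard) (card_coprime_divisors_le h n)
    _ = sieveRatio h n := by field_simp

lemma exists_mul_coprime (h : ℕ) {n : ℕ} (hn : n ≠ 0) :
    ∃ k b, k * b = n ∧ (∀ p ∈ k.primeFactors, p ∣ h) ∧ b.Coprime h := by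
  induction n using induction_on_primes with
  | zero => exact absurd rfl hn
  | one => exact ⟨1, 1, rfl, by simp, by simp⟩
  | prime_mul p n hp ih =>
    obtain ⟨k, b, rfl, h1, h2⟩ := ih fun h => hn (by simp [h])
    by_cases hph : p ∣ h
    · have hk0 : k ≠ 0 := by rintro rfl; simp at hn
      refine ⟨p * k, b, by ring, fun r hr => ?_, h2⟩
      rw [Nat.primeFactors_mul hp.ne_zero hk0, hp.primeFactors] at hr
      rcases mem_union.1 hr with h3 | h3
      · rw [mem_singleton.1 h3]; exact hph
      · exact h1 r h3
    · exact ⟨k, p * b, by ring, h1,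
        Nat.Coprime.mul_left ((Nat.Prime.coprime_iff_not_dvd hp).2 hph) h2⟩

/-- `∑_{d ∣ h} 1/d`. -/
noncomputable def invDivisorSum (h : ℕ) : ℝ := ∑ d ∈ h.divisors, (1 : ℝ) / d

lemma sum_one_div_sq_le (y : ℕ) : ∑ m ∈ Icc 1 y, (1 : ℝ) / (m : ℝ) ^ 2 ≤ 2 := by
  have : ∀ y : ℕ, ∑ m ∈ Icc 1 (y + 1), (1 : ℝ) / (m : ℝ) ^ 2 ≤ 2 - 1 / ((y : ℝ) + 1) := by
    intro y
    induction y with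
    | zero => norm_num
    | succ y ih =>
      rw [sum_Icc_succ_top (by omega)]
      have h1 : (1 : ℝ) / ((y + 1 + 1 : ℕ) : ℝ) ^ 2 ≤ 1 / ((y : ℝ) + 1) - 1 / ((y : ℝ) + 1 + 1) := by
        rw [div_sub_div _ _ (by positivity) (by positivity),
          div_le_div_iff₀ (by positivity) (by positivity)]
        push_cast
        nlinarith [Nat.cast_nonneg (α := ℝ) y]
      push_cast at *
      linarith
  rcases y with _ | y
  · simp
  · have h1 := this y
    have : (0 : ℝ) ≤ 1 / ((y : ℝ) + 1) := by positivity
    linarith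

/-- Write `k = m² d` with `d` squarefree. All primes of `d` divide `h`, hence `d ∣ h`, and the
squares contribute at most `∑ 1/m² ≤ 2`. -/
lemma sum_supported_le {h : ℕ} (hh0 : h ≠ 0) (y : ℕ) :
    ∑ k ∈ Icc 1 y with ∀ p ∈ k.primeFactors, p ∣ h, (1 : ℝ) / k ≤ 2 * invDivisorSum h := by
  classical
  have h1 : ∑ k ∈ Icc 1 y with ∀ p ∈ k.primeFactors, p ∣ h, (1 : ℝ) / k
      ≤ ∑ x ∈ h.divisors ×ˢ Icc 1 y, (1 : ℝ) / x.1 * (1 / (x.2 : ℝ) ^ 2) := by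
    refine sum_le_sum_of_exists (fun x => x.2 ^ 2 * x.1) (fun x _ => by positivity) fun k hk => ?_
    obtain ⟨hk1, hk2⟩ := mem_filter.1 hk
    obtain ⟨hk3, hk4⟩ := mem_Icc.1 hk1
    obtain ⟨d, m, hdm, hd⟩ := Nat.sq_mul_squarefree k
    have hm0 : m ≠ 0 := by rintro rfl; simp at hdm; omega
    have hd0 : d ≠ 0 := hd.ne_zero
    refine ⟨(d, m), mem_product.2 ⟨Nat.mem_divisors.2 ⟨?_, hh0⟩, mem_Icc.2 ⟨by omega, ?_⟩⟩, hdm, ?_⟩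
    · rw [← Nat.prod_primeFactors_of_squarefree hd]
      refine prod_primes_dvd h (fun p hp => (Nat.prime_of_mem_primeFactors hp).prime) fun p hp => ?_
      exact hk2 p (Nat.primeFactors_mono (hdm ▸ dvd_mul_left d (m ^ 2)) (by omega) hp)
    · refine le_trans ?_ hk4
      rw [← hdm]
      calc m ≤ m ^ 2 := Nat.le_self_pow (by norm_num) m
        _ ≤ m ^ 2 * d := Nat.le_mul_of_pos_right _ (Nat.pos_of_ne_zero hd0)
    · rw [← hdm]
      push_cast
      rw [one_div_mul_one_div, mul_comm]
  refine h1.trans ?_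
  rw [sum_product' (f := fun d m : ℕ => (1 : ℝ) / d * (1 / (m : ℝ) ^ 2)), ← sum_mul_sum, mul_comm]
  exact mul_le_mul_of_nonneg_right (sum_one_div_sq_le y) (sum_nonneg fun _ _ => by positivity)

lemma harmonic_le_coprime_mul_supported (h y : ℕ) :
    ∑ n ∈ Icc 1 y, (1 : ℝ) / n ≤ (∑ b ∈ Icc 1 y with b.Coprime h, (1 : ℝ) / b)
      * ∑ k ∈ Icc 1 y with ∀ p ∈ k.primeFactors, p ∣ h, (1 : ℝ) / k := by
  classical
  rw [sum_mul_sum, ← sum_product']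
  refine sum_le_sum_of_exists (fun x => x.2 * x.1) (fun x _ => by positivity) fun n hn => ?_
  obtain ⟨hn1, hn2⟩ := mem_Icc.1 hn
  obtain ⟨k, b, hkb, h1, h2⟩ := exists_mul_coprime h (n := n) (by omega)
  have hk0 : 0 < k := Nat.pos_of_ne_zero (by rintro rfl; omega)
  have hb0 : 0 < b := Nat.pos_of_ne_zero (by rintro rfl; omega)
  refine ⟨(b, k), mem_product.2 ⟨mem_filter.2 ⟨mem_Icc.2 ⟨hb0, ?_⟩, h2⟩,
    mem_filter.2 ⟨mem_Icc.2 ⟨hk0, ?_⟩, h1⟩⟩, hkb, ?_⟩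
  · exact le_trans (by rw [← hkb]; exact Nat.le_mul_of_pos_left b hk0) hn2
  · exact le_trans (by rw [← hkb]; exact Nat.le_mul_of_pos_right k hb0) hn2
  · rw [← hkb]
    push_cast
    rw [one_div_mul_one_div, mul_comm]

lemma log_sq_le_sieveTotal {h : ℕ} (hh : 2 ∣ h) (hh0 : h ≠ 0) (y : ℕ) :
    Real.log (y + 1) ^ 2 ≤ sieveTotal h (y ^ 2) * (2 * invDivisorSum h) := by
  have hH : Real.log (y + 1) ≤ ∑ n ∈ Icc 1 y, (1 : ℝ) / n := by
    have := log_add_one_le_harmonic y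
    rw [harmonic_eq_sum_Icc] at this
    push_cast at this
    simpa using this
  set H := ∑ n ∈ Icc 1 y, (1 : ℝ) / n
  have h0 : 0 ≤ Real.log ((y : ℝ) + 1) :=
    Real.log_nonneg (by linarith [Nat.cast_nonneg (α := ℝ) y])
  have h1 := harmonic_le_coprime_mul_supported h y
  have h2 := sum_supported_le hh0 y
  have h3 := (harmonic_mul_coprime_le_sum_sieveRatio h y).trans
    (sum_sieveRatio_le_sieveTotal hh (y ^ 2))
  set C := ∑ b ∈ Icc 1 y with b.Coprime h, (1 : ℝ) / b
  have hC : 0 ≤ C := sum_nonneg fun _ _ => by positivity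
  have hs : 0 ≤ 2 * invDivisorSum h :=
    mul_nonneg zero_le_two (sum_nonneg fun _ _ => by positivity)
  have hH0 : 0 ≤ H := h0.trans hH
  calc Real.log (y + 1) ^ 2 ≤ H ^ 2 := by gcongr
    _ = H * H := sq H
    _ ≤ H * (C * (2 * invDivisorSum h)) := by
        gcongr
        exact h1.trans (mul_le_mul_of_nonneg_left h2 hC)
    _ = (H * C) * (2 * invDivisorSum h) := by ring
    _ ≤ _ := mul_le_mul_of_nonneg_right h3 hs

/-- The upper bound for prime pairs `n`, `n + h` in a dyadic interval. -/
lemma card_prime_pairs_mul_log_sq_le {h P : ℕ} (hh0 : h ≠ 0) (hP : 1 ≤ P) :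
    #{n ∈ Ioc P (P + P) | n.Prime ∧ (n + h).Prime} * Real.log P ^ 2
      ≤ 640 * P * invDivisorSum h := by
  have hs : 0 ≤ invDivisorSum h := sum_nonneg fun _ _ => by positivity
  set A := {n ∈ Ioc P (P + P) | n.Prime ∧ (n + h).Prime} with hA
  rcases eq_or_lt_of_le hP with rfl | hP1
  · simp only [Nat.cast_one, Real.log_one]
    norm_num
    exact hs
  by_cases hh : 2 ∣ h
  swap
  -- For odd `h` one of `n`, `n + h` is even, and both exceed 2.
  · have : A = ∅ := by
      rw [hA, filter_eq_empty_iff]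
      rintro n hn ⟨h1, h2⟩
      have h3 := (mem_Ioc.1 hn).1
      have h4 := h1.eq_two_or_odd
      have h5 := h2.eq_two_or_odd
      omega
    rw [this]
    simp only [card_empty, Nat.cast_zero, zero_mul]
    positivity
  -- With sieve level `Q = y²`, the error `4 Q⁴ = 4 y⁸` is at most `4P`, while `log P ≤ 8 log (y +
  -- 1)`. The constant is `640 = 8² · 2 · 5`.
  obtain ⟨y, hy1, hy2⟩ : ∃ y : ℕ, y ^ 8 ≤ P ∧ P < (y + 1) ^ 8 := by
    have hex : ∃ k : ℕ, P < (k + 1) ^ 8 :=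
      ⟨P, lt_of_lt_of_le (Nat.lt_succ_self P) (Nat.le_self_pow (by norm_num) _)⟩
    classical
    refine ⟨Nat.find hex, ?_, Nat.find_spec hex⟩
    rcases Nat.eq_zero_or_pos (Nat.find hex) with h0 | h0
    · rw [h0]; simp
    · have := Nat.find_min hex (m := Nat.find hex - 1) (by omega)
      rw [Nat.sub_add_cancel h0] at this
      exact not_lt.1 this
  have hy0 : 1 ≤ y := by
    by_contra hcon
    have : y = 0 := by omega
    subst this
    simp at hy2
    omega
  have hQP : y ^ 2 ≤ P := (Nat.pow_le_pow_right hy0 (by norm_num)).trans hy1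
  have hsel := card_sifted_mul_sieveTotal_le hh (y ^ 2) P P (Nat.one_le_pow _ _ hy0) A
    (filter_subset _ _) (by
      intro n hn p hp hpQ hdvd
      obtain ⟨h1, h2, h3⟩ := mem_filter.1 hn
      have h4 := (mem_Ioc.1 h1).1
      rcases hp.dvd_mul.1 hdvd with h5 | h5
      · have := (Nat.prime_dvd_prime_iff_eq hp h2).1 h5
        omega
      · have := (Nat.prime_dvd_prime_iff_eq hp h3).1 h5
        omega)
  have hP5 : (P : ℝ) + 4 * ((y ^ 2 : ℕ) : ℝ) ^ 4 ≤ 5 * P := by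
    have : ((y ^ 2 : ℕ) : ℝ) ^ 4 ≤ P := by
      have h1 : (y ^ 2) ^ 4 ≤ P := by rw [← pow_mul]; exact hy1
      exact_mod_cast h1
    linarith
  have hlog : Real.log P ≤ 8 * Real.log (y + 1) := by
    have hP' : (0 : ℝ) < P := by exact_mod_cast hP
    have : (P : ℝ) ≤ ((y : ℝ) + 1) ^ 8 := by exact_mod_cast hy2.le
    calc Real.log P ≤ Real.log (((y : ℝ) + 1) ^ 8) := Real.log_le_log hP' this
      _ = _ := by rw [Real.log_pow]; norm_num
  have hlog0 : 0 ≤ Real.log P := Real.log_natCast_nonneg P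
  have h1 := log_sq_le_sieveTotal hh hh0 y
  have h2 : (0 : ℝ) ≤ #A := Nat.cast_nonneg _
  calc #A * Real.log P ^ 2 ≤ #A * (8 * Real.log (y + 1)) ^ 2 := by gcongr
    _ = 64 * (#A * Real.log (y + 1) ^ 2) := by ring
    _ ≤ 64 * (#A * (sieveTotal h (y ^ 2) * (2 * invDivisorSum h))) := by gcongr
    _ = 128 * invDivisorSum h * (#A * sieveTotal h (y ^ 2)) := by ring
    _ ≤ 128 * invDivisorSum h * (5 * P) := by
        exact mul_le_mul_of_nonneg_left (hsel.trans hP5) (by positivity)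
    _ = _ := by ring

/-! ### Exponential sums and distances to the nearest integer -/

/-- The distance to the nearest integer. -/
noncomputable def distInt (x : ℝ) : ℝ := |x - round x|

lemma distInt_nonneg (x : ℝ) : 0 ≤ distInt x := abs_nonneg _

lemma distInt_le_half (x : ℝ) : distInt x ≤ 1 / 2 := abs_sub_round x

lemma distInt_le (x : ℝ) (n : ℤ) : distInt x ≤ |x - n| := round_le x n

lemma distInt_neg (x : ℝ) : distInt (-x) = distInt x := by
  have : ∀ x : ℝ, distInt (-x) ≤ distInt x := by
    intro x
    refine (distInt_le (-x) (-round x)).trans (le_of_eq ?_)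
    unfold distInt
    rw [← abs_neg]
    push_cast
    ring_nf
  refine le_antisymm (this x) ?_
  simpa using this (-x)

/-- The majorant of a sum of `e(mx)` over an initial segment of length at most `M`. -/
noncomputable def geomBound (M x : ℝ) : ℝ := 2 / (1 / M + 2 * distInt x)

lemma geomBound_nonneg {M : ℝ} (hM : 0 < M) (x : ℝ) : 0 ≤ geomBound M x := by
  have := distInt_nonneg x
  unfold geomBound
  positivity

lemma geomBound_le {M : ℝ} (hM : 0 < M) (x : ℝ) : geomBound M x ≤ 2 * M := by
  have := distInt_nonneg x
  unfold geomBound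
  rw [div_le_iff₀ (by positivity)]
  have : M * (1 / M) = 1 := by field_simp
  nlinarith

lemma geomBound_neg (M x : ℝ) : geomBound M (-x) = geomBound M x := by
  unfold geomBound; rw [distInt_neg]

lemma norm_e (x : ℝ) : ‖e x‖ = 1 := by
  have : 2 * (Real.pi : ℂ) * Complex.I * x = ((2 * Real.pi * x : ℝ) : ℂ) * Complex.I := by
    push_cast; ring
  rw [e, this, Complex.norm_exp_ofReal_mul_I]

lemma e_add (x y : ℝ) : e (x + y) = e x * e y := by
  unfold e; rw [← Complex.exp_add]; push_cast; ring_nf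

lemma e_nat_mul (m : ℕ) (x : ℝ) : e (m * x) = e x ^ m := by
  unfold e; rw [← Complex.exp_nat_mul]; push_cast; ring_nf

lemma conj_e (x : ℝ) : (starRingEnd ℂ) (e x) = e (-x) := by
  unfold e
  rw [← Complex.exp_conj]
  simp only [map_mul, Complex.conj_ofReal, Complex.conj_I, map_ofNat]
  push_cast
  ring_nf

/-- Here `|e(x) - 1| = 2 |sin πx|`, which is bounded below by Jordan's inequality after reducing `x`
modulo 1. -/
lemma four_mul_distInt_le (x : ℝ) : 4 * distInt x ≤ ‖e x - 1‖ := by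
  have h1 : e x = Complex.exp (Complex.I * ((2 * Real.pi * x : ℝ) : ℂ)) := by
    unfold e; push_cast; ring_nf
  rw [h1, Complex.norm_exp_I_mul_ofReal_sub_one]
  have h2 : 2 * Real.pi * x / 2 = Real.pi * x := by ring
  rw [h2, Real.norm_eq_abs, abs_mul, abs_two]
  have h3 : |Real.sin (Real.pi * x)| = |Real.sin (Real.pi * (x - round x))| := by
    have : Real.pi * (x - round x) = Real.pi * x - (round x : ℤ) * Real.pi := by ring
    rw [this, Real.sin_sub_int_mul_pi, abs_mul, abs_zpow, abs_neg, abs_one, one_zpow, one_mul]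
  rw [h3]
  have h4 : |Real.pi * (x - round x)| = Real.pi * distInt x := by
    rw [abs_mul, abs_of_pos Real.pi_pos]; rfl
  have h5 := Real.mul_abs_le_abs_sin (x := Real.pi * (x - round x)) (by
    rw [h4]; nlinarith [distInt_le_half x, Real.pi_pos])
  rw [h4] at h5
  have : 2 / Real.pi * (Real.pi * distInt x) = 2 * distInt x := by
    field_simp
  linarith

/-- The trivial bound `M` and the geometric-series bound `1/(2‖x‖)` are combined by adding
reciprocals. The resulting smooth majorant sums directly to a logarithm. -/
lemma norm_sum_e_le {M : ℝ} (hM : 0 < M) {K : ℕ} (hK : (K : ℝ) ≤ M) (x : ℝ) :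
    ‖∑ m ∈ Icc 1 K, e (m * x)‖ ≤ geomBound M x := by
  have h1 : ‖∑ m ∈ Icc 1 K, e (m * x)‖ ≤ M := by
    refine (norm_sum_le _ _).trans (le_trans (le_of_eq ?_) hK)
    simp [norm_e]
  have h2 : ‖∑ m ∈ Icc 1 K, e (m * x)‖ * ‖e x - 1‖ ≤ 2 := by
    rw [← norm_mul]
    have h3 : ∑ m ∈ Icc 1 K, e (m * x) = e x * ∑ i ∈ range K, e x ^ i := by
      rw [show Icc 1 K = Ico 1 (K + 1) by ext; simp, sum_Ico_eq_sum_range, mul_sum]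
      refine sum_congr (by simp) fun i _ => ?_
      rw [e_nat_mul, pow_add, pow_one]
    rw [h3, mul_assoc, geom_sum_mul, norm_mul, norm_e, one_mul]
    refine (norm_sub_le _ _).trans ?_
    rw [norm_pow, norm_e]
    norm_num
  have h3 := four_mul_distInt_le x
  have h4 := distInt_nonneg x
  unfold geomBound
  rw [le_div_iff₀ (by positivity), mul_add]
  set A := ‖∑ m ∈ Icc 1 K, e (m * x)‖
  have hA : 0 ≤ A := norm_nonneg _
  have h5 : A * (1 / M) ≤ 1 := by
    rw [mul_one_div, div_le_one hM]; exact h1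
  nlinarith

/-! ### Well-spaced multiples -/

/-- The number `ka/q` is not an integer, so it lies at least `1/q` from every integer. Replacing
`a/q` by `α` moves it by at most `|k|/q² ≤ 1/(2q)`. -/
lemma le_distInt_mul {a : ℤ} {q : ℕ} (hq : 0 < q) (haq : IsCoprime a (q : ℤ)) {α : ℝ}
    (hα : |α - (a : ℝ) / (q : ℝ)| ≤ 1 / (q : ℝ) ^ 2) {k : ℤ} (hk0 : k ≠ 0) (hk : 2 * |k| ≤ q) :
    1 / (2 * (q : ℝ)) ≤ distInt (k * α) := by
  have hq' : (0 : ℝ) < q := by exact_mod_cast hq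
  set n := round ((k : ℝ) * α) with hn
  have h1 : k * a - n * q ≠ 0 := by
    intro h
    have h2 : (q : ℤ) ∣ k * a := ⟨n, by linarith⟩
    have h3 : (q : ℤ) ∣ k := haq.symm.dvd_of_dvd_mul_right h2
    have h4 := Int.le_of_dvd (abs_pos.2 hk0) ((dvd_abs _ _).2 h3)
    have : 0 < |k| := abs_pos.2 hk0
    omega
  have h2 : (1 : ℝ) ≤ |(k : ℝ) * a - n * q| := by
    have : (1 : ℤ) ≤ |k * a - n * q| := Int.one_le_abs h1
    exact_mod_cast this
  have h3 : 1 / (q : ℝ) ≤ |(k : ℝ) * (a / q) - n| := by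
    have : (k : ℝ) * (a / q) - n = (k * a - n * q) / q := by field_simp
    rw [this, abs_div, abs_of_pos hq']
    gcongr
  have h4 : |(k : ℝ) * (α - a / q)| ≤ 1 / (2 * q) := by
    rw [abs_mul]
    have hk' : 2 * |(k : ℝ)| ≤ q := by exact_mod_cast hk
    calc |(k : ℝ)| * |α - a / q| ≤ (q / 2) * (1 / (q : ℝ) ^ 2) := by
          gcongr; linarith
      _ = _ := by field_simp
  have h5 : |(k : ℝ) * (a / q) - n| ≤ |(k : ℝ) * α - n| + |(k : ℝ) * (α - a / q)| := by
    have : (k : ℝ) * (a / q) - n = (k * α - n) - k * (α - a / q) := by ring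
    rw [this]
    exact abs_sub _ _
  have h6 : 1 / (q : ℝ) = 1 / (2 * q) + 1 / (2 * q) := by field_simp; norm_num
  change _ ≤ |(k : ℝ) * α - n|
  linarith

/-- The index of the cell of length `1 / (2q)` that contains the distance of `hα` to the nearest
integer. -/
noncomputable def distCell (q : ℕ) (α : ℝ) (h : ℕ) : ℕ := ⌊2 * (q : ℝ) * distInt (h * α)⌋₊

/-- The signed residues are spaced by at least `1/(2q)`, the cell length, so a cell holds at most
one residue of each sign. -/
lemma card_distCell_le {a : ℤ} {q : ℕ} (hq : 0 < q) (haq : IsCoprime a (q : ℤ)) {α : ℝ}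
    (hα : |α - (a : ℝ) / (q : ℝ)| ≤ 1 / (q : ℝ) ^ 2) {H : Finset ℕ}
    (hH : ∀ h ∈ H, ∀ h' ∈ H, 2 * |(h : ℤ) - h'| ≤ q) (k : ℕ) :
    #{h ∈ H | distCell q α h = k} ≤ 2 := by
  classical
  have hq' : (0 : ℝ) < q := by exact_mod_cast hq
  set t : ℕ → ℝ := fun h => (h : ℝ) * α - round ((h : ℝ) * α) with ht
  have key : ∀ h ∈ H, ∀ h' ∈ H, |2 * q * (t h - t h')| < 1 → h = h' := by
    intro h hh h' hh' hlt
    by_contra hne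
    have h1 : ((h : ℤ) - h') ≠ 0 := by omega
    have h2 := le_distInt_mul hq haq hα h1 (hH h hh h' hh')
    have h3 := distInt_le (((h : ℤ) - h' : ℤ) * α) (round ((h : ℝ) * α) - round ((h' : ℝ) * α))
    have h4 : (((h : ℤ) - h' : ℤ) * α : ℝ)
        - ((round ((h : ℝ) * α) - round ((h' : ℝ) * α) : ℤ) : ℝ) = t h - t h' := by
      simp only [ht]; push_cast; ring
    rw [h4] at h3
    rw [abs_mul, abs_of_pos (by positivity : (0 : ℝ) < 2 * q)] at hlt
    have h5 := h2.trans h3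
    rw [div_le_iff₀ (by positivity)] at h5
    linarith
  have hfl : ∀ h, distCell q α h = k → (k : ℝ) ≤ 2 * q * |t h| ∧ 2 * q * |t h| < k + 1 := by
    intro h hk
    rw [← hk]
    have := distInt_nonneg (h * α)
    exact ⟨Nat.floor_le (by positivity : 0 ≤ 2 * (q : ℝ) * distInt (h * α)),
      Nat.lt_floor_add_one _⟩
  have hsub : {h ∈ H | distCell q α h = k} ⊆
      {h ∈ H | distCell q α h = k ∧ 0 ≤ t h} ∪ {h ∈ H | distCell q α h = k ∧ t h < 0} := by
    intro h hh
    obtain ⟨h1, h2⟩ := mem_filter.1 hh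
    rcases le_or_gt 0 (t h) with h3 | h3
    · exact mem_union_left _ (mem_filter.2 ⟨h1, h2, h3⟩)
    · exact mem_union_right _ (mem_filter.2 ⟨h1, h2, h3⟩)
  refine (card_le_card hsub).trans ((card_union_le _ _).trans ?_)
  have h1 : #{h ∈ H | distCell q α h = k ∧ 0 ≤ t h} ≤ 1 := by
    refine card_le_one.2 fun x hx y hy => ?_
    obtain ⟨hx1, hx2, hx3⟩ := mem_filter.1 hx
    obtain ⟨hy1, hy2, hy3⟩ := mem_filter.1 hy
    have hx4 := hfl x hx2
    have hy4 := hfl y hy2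
    rw [abs_of_nonneg hx3] at hx4
    rw [abs_of_nonneg hy3] at hy4
    refine key x hx1 y hy1 (abs_lt.2 ⟨?_, ?_⟩) <;> linarith [hx4.1, hx4.2, hy4.1, hy4.2]
  have h2 : #{h ∈ H | distCell q α h = k ∧ t h < 0} ≤ 1 := by
    refine card_le_one.2 fun x hx y hy => ?_
    obtain ⟨hx1, hx2, hx3⟩ := mem_filter.1 hx
    obtain ⟨hy1, hy2, hy3⟩ := mem_filter.1 hy
    have hx4 := hfl x hx2
    have hy4 := hfl y hy2
    rw [abs_of_neg hx3] at hx4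
    rw [abs_of_neg hy3] at hy4
    refine key x hx1 y hy1 (abs_lt.2 ⟨?_, ?_⟩) <;> linarith [hx4.1, hx4.2, hy4.1, hy4.2]
  omega

lemma sum_distCell_le {a : ℤ} {q : ℕ} (hq : 0 < q) (haq : IsCoprime a (q : ℤ)) {α : ℝ}
    (hα : |α - (a : ℝ) / (q : ℝ)| ≤ 1 / (q : ℝ) ^ 2) {H : Finset ℕ}
    (hH : ∀ h ∈ H, ∀ h' ∈ H, 2 * |(h : ℤ) - h'| ≤ q) {K : Finset ℕ}
    (hK : ∀ h ∈ H, distCell q α h ∈ K) {ψ : ℕ → ℝ} (hψ : ∀ k, 0 ≤ ψ k) :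
    ∑ h ∈ H, ψ (distCell q α h) ≤ 2 * ∑ k ∈ K, ψ k := by
  rw [← sum_fiberwise_of_maps_to hK, mul_sum]
  refine sum_le_sum fun k _ => ?_
  have : ∑ h ∈ H with distCell q α h = k, ψ (distCell q α h)
      = #{h ∈ H | distCell q α h = k} * ψ k := by
    rw [sum_congr rfl fun h hh => by rw [(mem_filter.1 hh).2], sum_const, nsmul_eq_mul]
  rw [this]
  refine mul_le_mul_of_nonneg_right ?_ (hψ k)
  exact_mod_cast card_distCell_le hq haq hα hH k

lemma geomBound_le_distCell {q : ℕ} (hq : 0 < q) {M : ℝ} (hM : 0 < M) (α : ℝ) (h : ℕ) :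
    geomBound M (h * α) ≤ 2 * q / (q / M + distCell q α h) := by
  have hq' : (0 : ℝ) < q := by exact_mod_cast hq
  have h0 := distInt_nonneg (h * α)
  have h1 : (distCell q α h : ℝ) ≤ 2 * q * distInt (h * α) := Nat.floor_le (by positivity)
  unfold geomBound
  rw [div_le_div_iff₀ (by positivity) (by positivity)]
  have : q / M = q * (1 / M) := by ring
  rw [this]
  nlinarith

lemma sum_one_div_add_le {x : ℝ} (hx : 0 < x) (n : ℕ) :
    ∑ k ∈ Icc 1 n, 1 / (x + k) ≤ Real.log (1 + n / x) := by
  induction n with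
  | zero => simp
  | succ n ih =>
    rw [sum_Icc_succ_top (by omega)]
    have hn : (0 : ℝ) ≤ n := Nat.cast_nonneg n
    have h1 : (1 : ℝ) + ((n + 1 : ℕ) : ℝ) / x = (1 + n / x) * ((x + (n + 1)) / (x + n)) := by
      push_cast
      field_simp
    rw [h1, Real.log_mul (by positivity) (by positivity)]
    have h2 := Real.one_sub_inv_le_log_of_pos
      (by positivity : 0 < (x + ((n : ℝ) + 1)) / (x + n))
    have h3 : 1 - ((x + ((n : ℝ) + 1)) / (x + n))⁻¹ = 1 / (x + ((n + 1 : ℕ) : ℝ)) := by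
      push_cast
      field_simp
      ring_nf
    linarith

lemma sum_cell_bound_le {q : ℕ} (hq : 0 < q) {M : ℝ} (hM : 0 < M) (n : ℕ) :
    ∑ k ∈ Icc 1 n, 2 * (q : ℝ) / (q / M + k) ≤ 2 * q * Real.log (1 + n * M / q) := by
  have hq' : (0 : ℝ) < q := by exact_mod_cast hq
  have h1 := sum_one_div_add_le (div_pos hq' hM) n
  have h2 : (n : ℝ) / (q / M) = n * M / q := by field_simp
  rw [h2] at h1
  calc _ = 2 * q * ∑ k ∈ Icc 1 n, 1 / (q / M + k) := by
        rw [mul_sum]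
        exact sum_congr rfl fun k _ => by ring
    _ ≤ _ := by gcongr

/-- Fewer than `q / 2` multiples of `α`. -/
lemma sum_geomBound_le_of_short {a : ℤ} {q : ℕ} (hq : 0 < q) (haq : IsCoprime a (q : ℤ)) {α : ℝ}
    (hα : |α - (a : ℝ) / (q : ℝ)| ≤ 1 / (q : ℝ) ^ 2) {M : ℝ} (hM : 0 < M) {P : ℕ} (hP : 1 ≤ P)
    (hPq : 2 * P ≤ q) :
    ∑ h ∈ Ico 1 P, geomBound M (h * α) ≤ 2 * q + 4 * q * Real.log (1 + P * M / q) := by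
  have hq' : (0 : ℝ) < q := by exact_mod_cast hq
  have hP' : (0 : ℝ) < P := by exact_mod_cast hP
  set ψ : ℕ → ℝ := fun k => 2 * q / (q / M + k) with hψ
  have hψ0 : ∀ k, 0 ≤ ψ k := fun k => by simp only [hψ]; positivity
  have hle : ∑ h ∈ Ico 1 P, geomBound M (h * α) ≤ ∑ h ∈ Ico 1 P, ψ (distCell q α h) :=
    sum_le_sum fun h _ => geomBound_le_distCell hq hM α h
  refine hle.trans ?_
  rw [← sum_filter_add_sum_filter_not (Ico 1 P) (fun h => P < distCell q α h)]
  -- Far cells need no spacing: fewer than `P` terms remain, each at most `2q/P`. Cutting at `P`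
  -- puts `PM/q` inside the logarithm.
  have h1 : ∑ h ∈ Ico 1 P with P < distCell q α h, ψ (distCell q α h) ≤ 2 * q := by
    calc _ ≤ ∑ h ∈ Ico 1 P with P < distCell q α h, 2 * (q : ℝ) / P := by
          refine sum_le_sum fun h hh => ?_
          have h2 : (P : ℝ) < distCell q α h := by exact_mod_cast (mem_filter.1 hh).2
          simp only [hψ]
          gcongr
          have : 0 < q / M := by positivity
          linarith
      _ = #{h ∈ Ico 1 P | P < distCell q α h} * (2 * (q : ℝ) / P) := by
          rw [sum_const, nsmul_eq_mul]
      _ ≤ P * (2 * (q : ℝ) / P) := by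
          gcongr
          refine (card_filter_le _ _).trans ?_
          simp
      _ = 2 * q := by field_simp
  have h2 : ∑ h ∈ Ico 1 P with ¬ P < distCell q α h, ψ (distCell q α h)
      ≤ 2 * ∑ k ∈ Icc 1 P, ψ k := by
    refine sum_distCell_le hq haq hα ?_ ?_ hψ0
    · intro h hh h' hh'
      have h3 := mem_Ico.1 (mem_filter.1 hh).1
      have h4 := mem_Ico.1 (mem_filter.1 hh').1
      rcases abs_cases ((h : ℤ) - h') with ⟨h5, -⟩ | ⟨h5, -⟩ <;> rw [h5] <;> omega
    · intro h hh
      obtain ⟨h3, h4⟩ := mem_filter.1 hh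
      have h5 := mem_Ico.1 h3
      refine mem_Icc.2 ⟨?_, not_lt.1 h4⟩
      -- Since `h` itself is at most `q/2`, cell `0` is empty. This is why no term of size `M`
      -- appears in the short case.
      have h6 := le_distInt_mul hq haq hα (k := (h : ℤ)) (by omega) (by
        rw [abs_of_nonneg (by omega)]; omega)
      refine Nat.le_floor ?_
      rw [div_le_iff₀ (by positivity)] at h6
      push_cast at h6 ⊢
      linarith
  have h3 := sum_cell_bound_le hq hM P
  linarith

/-- A block of `q/2 + 1` consecutive integers has differences at most `q/2`. Unlike the short case,
cell `0` may be occupied and gives the term `4M`. -/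
lemma sum_geomBound_block_le {a : ℤ} {q : ℕ} (hq : 0 < q) (haq : IsCoprime a (q : ℤ)) {α : ℝ}
    (hα : |α - (a : ℝ) / (q : ℝ)| ≤ 1 / (q : ℝ) ^ 2) {M : ℝ} (hM : 0 < M) (b : ℕ) :
    ∑ h ∈ Ico b (b + (q / 2 + 1)), geomBound M (h * α)
      ≤ 4 * M + 4 * q * Real.log (1 + M) := by
  have hq' : (0 : ℝ) < q := by exact_mod_cast hq
  set ψ : ℕ → ℝ := fun k => 2 * q / (q / M + k) with hψ
  have hψ0 : ∀ k, 0 ≤ ψ k := fun k => by simp only [hψ]; positivity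
  have hle : ∑ h ∈ Ico b (b + (q / 2 + 1)), geomBound M (h * α)
      ≤ ∑ h ∈ Ico b (b + (q / 2 + 1)), ψ (distCell q α h) :=
    sum_le_sum fun h _ => geomBound_le_distCell hq hM α h
  have h2 : ∑ h ∈ Ico b (b + (q / 2 + 1)), ψ (distCell q α h) ≤ 2 * ∑ k ∈ Icc 0 q, ψ k := by
    refine sum_distCell_le hq haq hα ?_ ?_ hψ0
    · intro h hh h' hh'
      have h3 := mem_Ico.1 hh
      have h4 := mem_Ico.1 hh'
      rcases abs_cases ((h : ℤ) - h') with ⟨h5, -⟩ | ⟨h5, -⟩ <;> rw [h5] <;> omega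
    · intro h _
      refine mem_Icc.2 ⟨Nat.zero_le _, Nat.floor_le_of_le ?_⟩
      nlinarith [distInt_le_half (h * α)]
  have h3 := sum_cell_bound_le hq hM q
  have h4 : ∑ k ∈ Icc 0 q, ψ k = ψ 0 + ∑ k ∈ Icc 1 q, ψ k := by
    rw [← add_sum_Ioc_eq_sum_Icc (Nat.zero_le q)]
    rfl
  have h5 : ψ 0 = 2 * M := by
    simp only [hψ]; push_cast; field_simp; ring
  have h6 : (q : ℝ) * M / q = M := by field_simp
  rw [h6] at h3
  rw [h4, h5] at h2
  linarith

/-- At least `q / 2` multiples of `α`. -/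
lemma sum_geomBound_le_of_long {a : ℤ} {q : ℕ} (hq : 0 < q) (haq : IsCoprime a (q : ℤ)) {α : ℝ}
    (hα : |α - (a : ℝ) / (q : ℝ)| ≤ 1 / (q : ℝ) ^ 2) {M : ℝ} (hM : 0 < M) {P : ℕ}
    (hPq : q ≤ 2 * P) :
    ∑ h ∈ Ico 1 P, geomBound M (h * α)
      ≤ 16 * P * M / q + 16 * P * Real.log (1 + M) := by
  have hq' : (0 : ℝ) < q := by exact_mod_cast hq
  set C := 4 * M + 4 * q * Real.log (1 + M) with hC
  have hlog : 0 ≤ Real.log (1 + M) := Real.log_nonneg (by linarith)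
  have hC0 : 0 ≤ C := by positivity
  set l := q / 2 + 1 with hl
  have hblocks : ∀ n : ℕ, ∑ h ∈ range (n * l), geomBound M (h * α) ≤ n * C := by
    intro n
    induction n with
    | zero => simp
    | succ n ih =>
      have h1 := sum_geomBound_block_le hq haq hα hM (n * l)
      rw [← hl] at h1
      have h2 : (n + 1) * l = n * l + l := by ring
      rw [h2, ← sum_range_add_sum_Ico _ (Nat.le_add_right (n * l) l)]
      push_cast
      linarith
  have hsub : Ico 1 P ⊆ range ((P / l + 1) * l) := by
    intro h hh
    have h1 := (mem_Ico.1 hh).2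
    have h2 := Nat.lt_div_mul_add (a := P) (b := l) (by omega)
    rw [mem_range, add_mul, one_mul]
    omega
  have h1 : ∑ h ∈ Ico 1 P, geomBound M (h * α) ≤ ((P / l + 1 : ℕ) : ℝ) * C :=
    (sum_le_sum_of_subset_of_nonneg hsub fun h _ _ => geomBound_nonneg hM _).trans (hblocks _)
  have h2 : ((P / l + 1 : ℕ) : ℝ) ≤ 4 * P / q := by
    have hlq : (q : ℝ) ≤ 2 * l := by exact_mod_cast (by omega : q ≤ 2 * l)
    have hPq' : (q : ℝ) ≤ 2 * P := by exact_mod_cast hPq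
    have h3 : ((P / l : ℕ) : ℝ) ≤ P / l := Nat.cast_div_le
    have h4 : (P : ℝ) / l ≤ 2 * P / q := by
      rw [div_le_div_iff₀ (by linarith) hq']
      nlinarith [Nat.cast_nonneg (α := ℝ) P]
    have h5 : (1 : ℝ) ≤ 2 * P / q := by rw [le_div_iff₀ hq']; linarith
    have h6 : (4 : ℝ) * P / q = 2 * P / q + 2 * P / q := by ring
    push_cast
    linarith
  calc _ ≤ ((P / l + 1 : ℕ) : ℝ) * C := h1
    _ ≤ 4 * P / q * C := by gcongr
    _ = _ := by rw [hC]; field_simp; ring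

/-! ### Sums weighted by `∑_{d ∣ h} 1/d` -/

lemma invDivisorSum_le {h P D : ℕ} (hhP : h < P) (hh0 : 0 < h) :
    invDivisorSum h ≤ (1 + Real.log D) + ∑ d ∈ Ioc D P, if d ∣ h then (1 : ℝ) / d else 0 := by
  have h1 : invDivisorSum h = ∑ d ∈ Icc 1 P, if d ∣ h then (1 : ℝ) / d else 0 := by
    rw [← sum_filter, invDivisorSum]
    refine sum_congr ?_ fun _ _ => rfl
    ext d
    simp only [Nat.mem_divisors, mem_filter, mem_Icc]
    refine ⟨fun ⟨h1, _⟩ => ⟨⟨Nat.pos_of_dvd_of_pos h1 hh0, ?_⟩, h1⟩, fun h1 => ⟨h1.2, by omega⟩⟩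
    exact (Nat.le_of_dvd hh0 h1).trans hhP.le
  have hnn : ∀ d : ℕ, (0 : ℝ) ≤ if d ∣ h then (1 : ℝ) / d else 0 := by
    intro d; split_ifs <;> positivity
  have hharm : ∑ d ∈ Icc 1 D, (1 : ℝ) / d ≤ 1 + Real.log D := by
    have := harmonic_le_one_add_log D
    rw [harmonic_eq_sum_Icc] at this
    push_cast at this
    simpa using this
  have h2 : Icc 1 P ⊆ Icc 1 D ∪ Ioc D P := by
    intro d hd
    simp only [mem_union, mem_Icc, mem_Ioc] at *
    omega
  have hdisj : Disjoint (Icc 1 D) (Ioc D P) := by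
    rw [disjoint_left]
    intro d hd hd'
    simp only [mem_Icc, mem_Ioc] at *
    omega
  rw [h1]
  refine (sum_le_sum_of_subset_of_nonneg h2 fun d _ _ => hnn d).trans ?_
  rw [sum_union hdisj]
  gcongr
  refine le_trans (sum_le_sum fun d _ => ?_) hharm
  split_ifs
  · exact le_rfl
  · positivity

/-- Divisors up to `D` cost a harmonic sum. For larger ones `G` is bounded trivially, and averaging
over multiples of `d` leaves `P ∑_{d > D} 1/d² ≤ P/D`. -/
lemma sum_invDivisorSum_mul_le {G : ℕ → ℝ} {C : ℝ} (hG0 : ∀ h, 0 ≤ G h) (hGC : ∀ h, G h ≤ C)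
    {P D : ℕ} (hD : 1 ≤ D) :
    ∑ h ∈ Ico 1 P, invDivisorSum h * G h
      ≤ (1 + Real.log D) * ∑ h ∈ Ico 1 P, G h + C * P / D := by
  have hC : 0 ≤ C := (hG0 0).trans (hGC 0)
  have hD' : (0 : ℝ) < D := by exact_mod_cast hD
  have h1 : ∑ h ∈ Ico 1 P, invDivisorSum h * G h
      ≤ ∑ h ∈ Ico 1 P, ((1 + Real.log D) * G h
        + ∑ d ∈ Ioc D P, (if d ∣ h then (1 : ℝ) / d else 0) * C) := by
    refine sum_le_sum fun h hh => ?_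
    have hh' := mem_Ico.1 hh
    have h2 := invDivisorSum_le (D := D) hh'.2 hh'.1
    have h3 : 0 ≤ ∑ d ∈ Ioc D P, if d ∣ h then (1 : ℝ) / d else 0 :=
      sum_nonneg fun d _ => by split_ifs <;> positivity
    rw [← sum_mul]
    calc _ ≤ ((1 + Real.log D) + ∑ d ∈ Ioc D P, if d ∣ h then (1 : ℝ) / d else 0) * G h :=
          mul_le_mul_of_nonneg_right h2 (hG0 h)
      _ = (1 + Real.log D) * G h + (∑ d ∈ Ioc D P, if d ∣ h then (1 : ℝ) / d else 0) * G h := by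
          ring
      _ ≤ _ := by
          gcongr
          exact hGC h
  refine h1.trans ?_
  rw [sum_add_distrib, ← mul_sum]
  refine add_le_add_right ?_ _
  rw [sum_comm]
  rcases le_or_gt P D with hPD | hPD
  · rw [Ioc_eq_empty (by omega), sum_empty]
    positivity
  have h4 : ∀ d ∈ Ioc D P, ∑ h ∈ Ico 1 P, (if d ∣ h then (1 : ℝ) / d else 0) * C
      ≤ C * P * ((d : ℝ) ^ 2)⁻¹ := by
    intro d hd
    have hd0 : 0 < d := by have := (mem_Ioc.1 hd).1; omega
    have hd' : (0 : ℝ) < d := by exact_mod_cast hd0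
    have hcard : (#{h ∈ Ico 1 P | d ∣ h} : ℝ) ≤ P / d := by
      have h5 : #{h ∈ Ico 1 P | d ∣ h} ≤ #{h ∈ Ioc 0 P | d ∣ h} := by
        refine card_le_card (filter_subset_filter _ fun h hh => ?_)
        simp only [mem_Ico, mem_Ioc] at *
        omega
      rw [Nat.Ioc_filter_dvd_card_eq_div] at h5
      exact le_trans (by exact_mod_cast h5) Nat.cast_div_le
    rw [← sum_mul, ← sum_filter, sum_const, nsmul_eq_mul]
    calc _ ≤ (P : ℝ) / d * (1 / d) * C := by gcongr
      _ = _ := by field_simp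
  refine (sum_le_sum h4).trans ?_
  rw [← mul_sum]
  have h5 := sum_Ioc_inv_sq_le_sub (α := ℝ) (k := D) (n := P) (by omega) hPD.le
  have h6 : (0 : ℝ) ≤ (P : ℝ)⁻¹ := by positivity
  rw [div_eq_mul_inv]
  gcongr
  linarith

/-! ### The bilinear sum over a dyadic range of primes -/

lemma sum_norm_sq_le {s : Finset ℕ} {c : ℕ → ℂ} {N K : ℕ} {M C α : ℝ} (hM : 0 < M)
    (hKM : ∀ p ∈ s, ((N / p : ℕ) : ℝ) ≤ M) (hK : ∀ p ∈ s, N / p ≤ K) (hC : 0 ≤ C)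
    (hc : ∀ p ∈ s, ‖c p‖ ≤ C) :
    ∑ m ∈ Icc 1 K, ‖∑ p ∈ s, if m ≤ N / p then c p * e (m * (p * α)) else 0‖ ^ 2
      ≤ C ^ 2 * ∑ p ∈ s, ∑ p' ∈ s, geomBound M (((p : ℝ) - p') * α) := by
  set U : ℕ → ℂ := fun m => ∑ p ∈ s, if m ≤ N / p then c p * e (m * (p * α)) else 0 with hU
  have h1 : ((∑ m ∈ Icc 1 K, ‖U m‖ ^ 2 : ℝ) : ℂ)
      = ∑ p ∈ s, ∑ p' ∈ s, c p * (starRingEnd ℂ) (c p') *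
        ∑ m ∈ Icc 1 (min (N / p) (N / p')), e (m * (((p : ℝ) - p') * α)) := by
    have h2 : ∀ m, ((‖U m‖ ^ 2 : ℝ) : ℂ) = ∑ p ∈ s, ∑ p' ∈ s,
        if m ≤ min (N / p) (N / p') then
          c p * (starRingEnd ℂ) (c p') * e (m * (((p : ℝ) - p') * α)) else 0 := by
      intro m
      have : ((‖U m‖ ^ 2 : ℝ) : ℂ) = U m * (starRingEnd ℂ) (U m) := by
        rw [Complex.mul_conj, Complex.normSq_eq_norm_sq]
      rw [this]
      simp only [hU]
      rw [map_sum, sum_mul_sum]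
      refine sum_congr rfl fun p _ => sum_congr rfl fun p' _ => ?_
      by_cases h3 : m ≤ N / p
      · by_cases h4 : m ≤ N / p'
        · rw [if_pos h3, if_pos h4, if_pos (le_min h3 h4), map_mul, conj_e]
          have : (m : ℝ) * (((p : ℝ) - p') * α) = m * (p * α) + -(m * (p' * α)) := by ring
          rw [this, e_add]
          ring
        · rw [if_neg h4, if_neg fun h : m ≤ min (N / p) (N / p') => h4 (h.trans (min_le_right _ _))]
          simp
      · rw [if_neg h3, if_neg fun h : m ≤ min (N / p) (N / p') => h3 (h.trans (min_le_left _ _))]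
        simp
    push_cast
    have h2' : ∀ m, ((‖U m‖ : ℂ)) ^ 2 = ((‖U m‖ ^ 2 : ℝ) : ℂ) := by intro m; push_cast; rfl
    simp_rw [h2', h2]
    rw [sum_comm]
    refine sum_congr rfl fun p hp => ?_
    rw [sum_comm]
    refine sum_congr rfl fun p' _ => ?_
    rw [mul_sum, ← sum_filter]
    refine sum_congr ?_ fun _ _ => rfl
    ext m
    have := hK p hp
    simp only [mem_filter, mem_Icc]
    constructor
    · rintro ⟨h3, h4⟩
      exact ⟨h3.1, h4⟩
    · rintro ⟨h3, h4⟩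
      exact ⟨⟨h3, (h4.trans (min_le_left _ _)).trans this⟩, h4⟩
  have h0 : 0 ≤ ∑ m ∈ Icc 1 K, ‖U m‖ ^ 2 := sum_nonneg fun _ _ => by positivity
  have h3 : ∑ m ∈ Icc 1 K, ‖U m‖ ^ 2 = ‖((∑ m ∈ Icc 1 K, ‖U m‖ ^ 2 : ℝ) : ℂ)‖ := by
    rw [Complex.norm_real, Real.norm_of_nonneg h0]
  rw [h3, h1, mul_sum]
  refine (norm_sum_le _ _).trans (sum_le_sum fun p hp => ?_)
  rw [mul_sum]
  refine (norm_sum_le _ _).trans (sum_le_sum fun p' hp' => ?_)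
  rw [norm_mul, norm_mul, RCLike.norm_conj, sq]
  have h4 := norm_sum_e_le (K := min (N / p) (N / p')) hM
    (le_trans (by exact_mod_cast min_le_left _ _) (hKM p hp)) (((p : ℝ) - p') * α)
  have h5 := hc p hp
  have h6 := hc p' hp'
  gcongr

lemma sum_pairs_le {P : ℕ} {M α : ℝ} (hM : 0 < M) (hP : 1 ≤ P) {s : Finset ℕ}
    (hs : s = {p ∈ Ioc P (P + P) | p.Prime}) :
    Real.log (2 * P) ^ 2 * ∑ p ∈ s, ∑ p' ∈ s, geomBound M (((p : ℝ) - p') * α)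
      ≤ 2 * M * P * Real.log (2 * P) ^ 2
        + 5120 * P * ∑ h ∈ Ico 1 P, invDivisorSum h * geomBound M (h * α) := by
  have hP' : (1 : ℝ) ≤ P := by exact_mod_cast hP
  set G : ℕ → ℝ := fun h => geomBound M (h * α) with hG
  have hG0 : ∀ h, 0 ≤ G h := fun h => geomBound_nonneg hM _
  have hmem : ∀ p ∈ s, P < p ∧ p ≤ P + P ∧ p.Prime := by
    intro p hp
    rw [hs] at hp
    obtain ⟨h1, h2⟩ := mem_filter.1 hp
    exact ⟨(mem_Ioc.1 h1).1, (mem_Ioc.1 h1).2, h2⟩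
  set W := ∑ x ∈ s ×ˢ s with x.2 < x.1, G (x.1 - x.2) with hW
  have hsplit : ∑ p ∈ s, ∑ p' ∈ s, geomBound M (((p : ℝ) - p') * α) ≤ 2 * M * P + 2 * W := by
    have h1 : ∑ p ∈ s, ∑ p' ∈ s, geomBound M (((p : ℝ) - p') * α)
        = ∑ x ∈ s ×ˢ s, ((if x.1 = x.2 then geomBound M 0 else 0)
          + (if x.2 < x.1 then G (x.1 - x.2) else 0)
          + (if x.1 < x.2 then G (x.2 - x.1) else 0)) := by
      rw [sum_product]
      refine sum_congr rfl fun p _ => sum_congr rfl fun p' _ => ?_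
      rcases lt_trichotomy p p' with h | h | h
      · rw [if_neg h.ne, if_neg h.not_gt, if_pos h]
        simp only [hG, Nat.cast_sub h.le]
        rw [← geomBound_neg]
        ring_nf
      · subst h
        simp
      · rw [if_neg h.ne', if_pos h, if_neg h.not_gt]
        simp only [hG, Nat.cast_sub h.le]
        ring_nf
    have h2 : ∑ x ∈ s ×ˢ s, (if x.1 < x.2 then G (x.2 - x.1) else 0) = W := by
      rw [sum_product_right, ← sum_product' (f := fun a b => if b < a then G (a - b) else 0), hW,
        sum_filter]
    have h3 : ∑ x ∈ s ×ˢ s, (if x.1 = x.2 then geomBound M 0 else 0) ≤ 2 * M * P := by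
      rw [sum_product]
      simp only [sum_ite_eq, sum_ite_mem, inter_self, sum_const, nsmul_eq_mul]
      have h4 : (#s : ℝ) ≤ P := by
        have : #s ≤ #(Ioc P (P + P)) := by rw [hs]; exact card_filter_le _ _
        rw [Nat.card_Ioc] at this
        exact_mod_cast (by omega : #s ≤ P)
      have h5 := geomBound_le hM 0
      have h6 := geomBound_nonneg hM 0
      calc (#s : ℝ) * geomBound M 0 ≤ P * (2 * M) := by gcongr
        _ = _ := by ring
    rw [h1, sum_add_distrib, sum_add_distrib, h2, ← sum_filter (fun x : ℕ × ℕ => x.2 < x.1)]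
    linarith
  have hWle : Real.log (2 * P) ^ 2 * W ≤ 2560 * P * ∑ h ∈ Ico 1 P, invDivisorSum h * G h := by
    have hmaps : ∀ x ∈ {x ∈ s ×ˢ s | x.2 < x.1}, x.1 - x.2 ∈ Ico 1 P := by
      intro x hx
      obtain ⟨h1, h2⟩ := mem_filter.1 hx
      have h3 := hmem _ (mem_product.1 h1).1
      have h4 := hmem _ (mem_product.1 h1).2
      rw [mem_Ico]
      omega
    rw [hW, ← sum_fiberwise_of_maps_to hmaps, mul_sum, mul_sum]
    refine sum_le_sum fun h hh => ?_
    obtain ⟨hh1, hh2⟩ := mem_Ico.1 hh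
    set X := {x ∈ {x ∈ s ×ˢ s | x.2 < x.1} | x.1 - x.2 = h} with hX
    have h1 : ∑ x ∈ X, G (x.1 - x.2) = #X * G h := by
      rw [sum_congr rfl fun x hx => by rw [(mem_filter.1 hx).2], sum_const, nsmul_eq_mul]
    have h2 : #X ≤ #{n ∈ Ioc P (P + P) | n.Prime ∧ (n + h).Prime} := by
      refine card_le_card_of_injOn Prod.snd ?_ ?_
      · intro x hx
        obtain ⟨h3, h4⟩ := mem_filter.1 (mem_coe.1 hx)
        obtain ⟨h5, h6⟩ := mem_filter.1 h3
        have h7 := hmem _ (mem_product.1 h5).1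
        have h8 := hmem _ (mem_product.1 h5).2
        have h9 : x.2 + h = x.1 := by omega
        refine mem_coe.2 (mem_filter.2 ⟨mem_Ioc.2 ⟨h8.1, h8.2.1⟩, h8.2.2, ?_⟩)
        rw [h9]
        exact h7.2.2
      · intro x hx y hy hxy
        obtain ⟨h3, h4⟩ := mem_filter.1 (mem_coe.1 hx)
        obtain ⟨h5, h6⟩ := mem_filter.1 (mem_coe.1 hy)
        have h7 := (mem_filter.1 h3).2
        have h8 := (mem_filter.1 h5).2
        exact Prod.ext (by omega) hxy
    have h3 := card_prime_pairs_mul_log_sq_le (h := h) (by omega) hP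
    -- The range `1 ≤ h < P` forces `P ≥ 2`. The constant in the conclusion is `5120 = 2 · 2² ·
    -- 640`, the first 2 coming from the sign of `p - p'`.
    have h4 : Real.log (2 * P) ≤ 2 * Real.log P := by
      have : (2 : ℝ) ≤ P := by exact_mod_cast (by omega : 2 ≤ P)
      rw [Real.log_mul (by norm_num) (by positivity)]
      linarith [Real.log_le_log (by norm_num) this]
    have h5 : 0 ≤ Real.log (2 * P) := Real.log_nonneg (by linarith)
    rw [h1]
    calc Real.log (2 * P) ^ 2 * (#X * G h) ≤ (2 * Real.log P) ^ 2 * (#X * G h) := by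
          have := hG0 h
          gcongr
      _ = 4 * (#X * Real.log P ^ 2) * G h := by ring
      _ ≤ 4 * (640 * P * invDivisorSum h) * G h := by
          have h6 : #X * Real.log P ^ 2 ≤ 640 * P * invDivisorSum h := by
            refine le_trans ?_ h3
            gcongr
          have := hG0 h
          gcongr
      _ = _ := by ring
  nlinarith [mul_le_mul_of_nonneg_left hsplit (sq_nonneg (Real.log (2 * P)))]

/-- The bilinear sum over primes in `(P, 2P]` is controlled by sums of geometric series. -/
lemma norm_bilinear_sq_le {P N : ℕ} (hP : 1 ≤ P) (hPN : P ≤ N) {B α : ℝ} (hB : 0 ≤ B)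
    {f : ℕ → ℂ} (hf : ∀ n, ‖f n‖ ≤ B) :
    ‖∑ p ∈ Ioc P (P + P) with p.Prime, ∑ m ∈ Icc 1 (N / p),
        f p * f m * Real.log p * e (m * (p * α))‖ ^ 2
      ≤ B ^ 4 * N * (2 * (N / P) * Real.log (2 * P) ^ 2
        + 5120 * ∑ h ∈ Ico 1 P, invDivisorSum h * geomBound (N / P) (h * α)) := by
  have hP' : (1 : ℝ) ≤ P := by exact_mod_cast hP
  have hPN' : (P : ℝ) ≤ N := by exact_mod_cast hPN
  set M : ℝ := (N : ℝ) / P with hMdef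
  have hM1 : 1 ≤ M := by rw [hMdef, one_le_div (by linarith)]; exact hPN'
  have hM : 0 < M := by linarith
  set s := {p ∈ Ioc P (P + P) | p.Prime} with hs
  set K := N / P with hK
  have hlog : 0 ≤ Real.log (2 * P) := Real.log_nonneg (by linarith)
  have hPp : ∀ p ∈ s, P < p ∧ p ≤ P + P := fun p hp => mem_Ioc.1 (mem_filter.1 hp).1
  have hKp : ∀ p ∈ s, N / p ≤ K := fun p hp => Nat.div_le_div_left (hPp p hp).1.le hP
  have hKM : (K : ℝ) ≤ M := Nat.cast_div_le
  have hc : ∀ p ∈ s, ‖f p * Real.log p‖ ≤ B * Real.log (2 * P) := by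
    intro p hp
    obtain ⟨h1, h2⟩ := hPp p hp
    have h3 : (p : ℝ) ≤ 2 * P := by
      have : (p : ℝ) ≤ P + P := by exact_mod_cast h2
      linarith
    have h4 : (0 : ℝ) < p := by exact_mod_cast (by omega : 0 < p)
    rw [norm_mul, Complex.norm_real, Real.norm_of_nonneg (Real.log_natCast_nonneg p)]
    gcongr
    exact hf p
  have hT : ∑ p ∈ s, ∑ m ∈ Icc 1 (N / p), f p * f m * Real.log p * e (m * (p * α))
      = ∑ m ∈ Icc 1 K, f m *
        ∑ p ∈ s, if m ≤ N / p then (f p * Real.log p) * e (m * (p * α)) else 0 := by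
    have h1 : ∀ p ∈ s, ∑ m ∈ Icc 1 (N / p), f p * f m * Real.log p * e (m * (p * α))
        = ∑ m ∈ Icc 1 K,
          if m ≤ N / p then f m * ((f p * Real.log p) * e (m * (p * α))) else 0 := by
      intro p hp
      rw [← sum_filter]
      have := hKp p hp
      refine sum_congr ?_ fun m _ => by ring
      ext m
      simp only [mem_filter, mem_Icc]
      omega
    rw [sum_congr rfl h1, sum_comm]
    refine sum_congr rfl fun m _ => ?_
    rw [mul_sum]
    refine sum_congr rfl fun p _ => ?_
    rw [mul_ite, mul_zero]
  have hU := sum_norm_sq_le (α := α) hM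
    (fun p hp => le_trans (by exact_mod_cast hKp p hp) hKM) hKp (mul_nonneg hB hlog) hc
  set U : ℕ → ℂ := fun m =>
    ∑ p ∈ s, if m ≤ N / p then (f p * Real.log p) * e (m * (p * α)) else 0 with hUdef
  have hpairs := sum_pairs_le (α := α) hM hP hs
  have hPM : (P : ℝ) * M = N := by rw [hMdef]; field_simp
  calc ‖∑ p ∈ s, ∑ m ∈ Icc 1 (N / p), f p * f m * Real.log p * e (m * (p * α))‖ ^ 2
      = ‖∑ m ∈ Icc 1 K, f m * U m‖ ^ 2 := by rw [hT]
    _ ≤ (∑ m ∈ Icc 1 K, ‖f m‖ * ‖U m‖) ^ 2 := by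
        gcongr
        refine (norm_sum_le _ _).trans (sum_le_sum fun m _ => (norm_mul _ _).le)
    _ ≤ (∑ m ∈ Icc 1 K, ‖f m‖ ^ 2) * ∑ m ∈ Icc 1 K, ‖U m‖ ^ 2 := sum_mul_sq_le_sq_mul_sq _ _ _
    _ ≤ (M * B ^ 2) * ((B * Real.log (2 * P)) ^ 2
          * ∑ p ∈ s, ∑ p' ∈ s, geomBound M (((p : ℝ) - p') * α)) := by
        refine mul_le_mul ?_ hU (sum_nonneg fun _ _ => by positivity) (by positivity)
        calc ∑ m ∈ Icc 1 K, ‖f m‖ ^ 2 ≤ ∑ m ∈ Icc 1 K, B ^ 2 :=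
              sum_le_sum fun m _ => pow_le_pow_left₀ (norm_nonneg _) (hf m) 2
          _ = K * B ^ 2 := by simp
          _ ≤ M * B ^ 2 := by gcongr
    _ = M * B ^ 4 * (Real.log (2 * P) ^ 2
          * ∑ p ∈ s, ∑ p' ∈ s, geomBound M (((p : ℝ) - p') * α)) := by ring
    _ ≤ M * B ^ 4 * (2 * M * P * Real.log (2 * P) ^ 2
        + 5120 * P * ∑ h ∈ Ico 1 P, invDivisorSum h * geomBound M (h * α)) := by gcongr
    _ = _ := by rw [← hPM]; ring

/-! ### Estimates uniform in the dyadic parameter -/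

/-- The function `log(1 + x)/x` decreases, here by Bernoulli's inequality. It turns `q log(1 + N/q)`
into `(N/R) log(1 + R)` when `q ≤ N/R`. -/
lemma log_one_add_le_mul {x R : ℝ} (hR : 0 < R) (hx : R ≤ x) :
    Real.log (1 + x) ≤ x / R * Real.log (1 + R) := by
  have h1 : 1 ≤ x / R := by rw [one_le_div hR]; exact hx
  have h2 := one_add_mul_self_le_rpow_one_add (s := R) (by linarith) h1
  have h3 : x / R * R = x := by field_simp
  rw [h3] at h2
  have h4 := Real.log_le_log (by linarith) h2
  rwa [Real.log_rpow (by linarith)] at h4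

lemma log_one_add_le {x : ℝ} (hx : 1 ≤ x) : Real.log (1 + x) ≤ 1 + Real.log x := by
  have h1 : 1 + x ≤ Real.exp 1 * x := by nlinarith [Real.add_one_le_exp 1]
  have h2 := Real.log_le_log (by linarith) h1
  rwa [Real.log_mul (Real.exp_pos 1).ne' (by linarith), Real.log_exp] at h2

lemma half_le_floor {x : ℝ} (hx : 1 ≤ x) : x / 2 ≤ ⌊x⌋₊ := by
  have h1 := Nat.lt_floor_add_one x
  have h2 : (1 : ℝ) ≤ ⌊x⌋₊ := by exact_mod_cast Nat.le_floor (by exact_mod_cast hx)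
  linarith

lemma log_floor_le {x : ℝ} (hx : 1 ≤ x) : Real.log ⌊x⌋₊ ≤ Real.log x := by
  refine Real.log_le_log ?_ (Nat.floor_le (by linarith))
  linarith [half_le_floor hx]

lemma one_add_log_le_log_four_mul {R : ℝ} (hR : 0 < R) : 1 + Real.log R ≤ Real.log (4 * R) := by
  rw [Real.log_mul (by norm_num) hR.ne']
  have : (1 : ℝ) ≤ Real.log 4 := by
    rw [Real.le_log_iff_exp_le (by norm_num)]
    linarith [Real.exp_one_lt_d9]
  linarith

lemma sum_weighted_geomBound_le {a : ℤ} {q N P : ℕ} {α R : ℝ} (haq : IsCoprime a (q : ℤ))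
    (hα : |α - (a : ℝ) / (q : ℝ)| ≤ 1 / (q : ℝ) ^ 2) (hR : 1 ≤ R) (hL : 17 ≤ Real.log (4 * R))
    (hRq : R ≤ q) (hqN : (q : ℝ) ≤ N / R) (hP : 1 ≤ P) (hPN : P ≤ N) :
    ∑ h ∈ Ico 1 P, invDivisorSum h * geomBound (N / P) (h * α)
      ≤ N * (5 * Real.log (4 * R) ^ 2 / R
        + 20 * (1 + Real.log ((N : ℝ) / P)) ^ 2 / ((N : ℝ) / P)) := by
  have hP' : (1 : ℝ) ≤ P := by exact_mod_cast hP
  have hPN' : (P : ℝ) ≤ N := by exact_mod_cast hPN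
  have hN' : (0 : ℝ) < N := by linarith
  set M : ℝ := (N : ℝ) / P with hMdef
  set L := Real.log (4 * R) with hLdef
  have hM1 : 1 ≤ M := by rw [hMdef, one_le_div (by linarith)]; exact hPN'
  have hM : 0 < M := by linarith
  have hR0 : 0 < R := by linarith
  have hLL : 17 * L ≤ L ^ 2 := by
    rw [sq]; exact mul_le_mul_of_nonneg_right hL (by linarith)
  have hq' : (0 : ℝ) < q := by linarith
  have hq : 0 < q := by exact_mod_cast hq'
  have hPM : (P : ℝ) * M = N := by rw [hMdef]; field_simp
  have hlogR : 0 ≤ Real.log R := Real.log_nonneg hR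
  have hlogM : 0 ≤ Real.log M := Real.log_nonneg hM1
  have hLR := one_add_log_le_log_four_mul hR0
  rw [← hLdef] at hLR
  have hL1R : Real.log (1 + R) ≤ L := (log_one_add_le hR).trans hLR
  have hG0 : ∀ h : ℕ, 0 ≤ geomBound M (h * α) := fun h => geomBound_nonneg hM _
  have hG2 : ∀ h : ℕ, geomBound M (h * α) ≤ 2 * M := fun h => geomBound_le hM _
  have hsum0 : 0 ≤ ∑ h ∈ Ico 1 P, geomBound M (h * α) := sum_nonneg fun h _ => hG0 h
  have htail : ∀ {x : ℝ}, 1 ≤ x → 2 * M * P / (⌊x⌋₊ : ℝ) ≤ 4 * N / x := by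
    intro x hx
    have h1 := half_le_floor hx
    rw [div_le_div_iff₀ (by linarith) (by linarith)]
    have : 2 * M * P = 2 * N := by rw [← hPM]; ring
    rw [this]
    nlinarith
  have hqN' : (q : ℝ) * R ≤ N := by rwa [le_div_iff₀ hR0] at hqN
  rcases le_or_gt (2 * P) q with hPq | hPq
  · have h1 := sum_invDivisorSum_mul_le hG0 hG2 (P := P) (D := ⌊R⌋₊)
      (Nat.le_floor (by exact_mod_cast hR))
    have h2 := sum_geomBound_le_of_short hq haq hα hM hP hPq
    rw [hPM] at h2
    have h3 : R ≤ N / q := by rw [le_div_iff₀ hq']; linarith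
    have h4 := log_one_add_le_mul hR0 h3
    have h5 : ∑ h ∈ Ico 1 P, geomBound M (h * α) ≤ N / R * (2 + 4 * L) := by
      calc _ ≤ 2 * q + 4 * q * Real.log (1 + N / q) := h2
        _ ≤ 2 * q + 4 * q * ((N : ℝ) / q / R * Real.log (1 + R)) := by gcongr
        _ = 2 * q + 4 * (N / R) * Real.log (1 + R) := by field_simp
        _ ≤ 2 * (N / R) + 4 * (N / R) * L := by gcongr
        _ = _ := by ring
    have h6 := htail hR
    have h7 : (1 + Real.log ⌊R⌋₊) * ∑ h ∈ Ico 1 P, geomBound M (h * α)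
        ≤ L * (N / R * (2 + 4 * L)) := by
      refine mul_le_mul ?_ h5 hsum0 (by linarith)
      linarith [log_floor_le hR]
    have h8 : (0 : ℝ) ≤ N * (20 * (1 + Real.log M) ^ 2 / M) := by positivity
    have h9 : L * (N / R * (2 + 4 * L)) + 4 * N / R ≤ N * (5 * L ^ 2 / R) := by
      have : N * (5 * L ^ 2 / R) - (L * (N / R * (2 + 4 * L)) + 4 * N / R)
          = N / R * (L ^ 2 - 2 * L - 4) := by ring
      have h10 : 0 ≤ N / R * (L ^ 2 - 2 * L - 4) := by
        apply mul_nonneg (by positivity)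
        linarith
      linarith
    rw [mul_add]
    linarith only [h1, h6, h7, h8, h9]
  · have h2 := sum_geomBound_le_of_long hq haq hα hM hPq.le
    have h16 : (16 : ℝ) * P * M / q = 16 * N / q := by rw [← hPM]; ring
    have hPNM : (P : ℝ) = N / M := by rw [← hPM]; field_simp
    rw [h16] at h2
    -- Cutting the divisors at `min M R` bounds `1 + log D` both by `L` and by `1 + log M`. Each of
    -- the two terms of the long estimate then receives the logarithm that suits it.
    set x := min M R with hx
    have hx1 : 1 ≤ x := le_min hM1 hR
    have h1 := sum_invDivisorSum_mul_le hG0 hG2 (P := P) (D := ⌊x⌋₊)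
      (Nat.le_floor (by exact_mod_cast hx1))
    have h3 := htail hx1
    have h4 : 4 * N / x ≤ 4 * N / M + 4 * N / R := by
      rcases min_choice M R with h | h <;> rw [hx, h]
      · have : 0 ≤ 4 * N / R := by positivity
        linarith
      · have : 0 ≤ 4 * N / M := by positivity
        linarith
    have hlx := log_floor_le hx1
    have hlx0 : 0 ≤ Real.log ⌊x⌋₊ := Real.log_natCast_nonneg _
    have hlxM : Real.log x ≤ Real.log M := Real.log_le_log (by linarith) (min_le_left _ _)
    have hlxR : Real.log x ≤ Real.log R := Real.log_le_log (by linarith) (min_le_right _ _)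
    have hl1M := log_one_add_le hM1
    have hl1M0 : 0 ≤ Real.log (1 + M) := Real.log_nonneg (by linarith)
    have h5 : (1 + Real.log ⌊x⌋₊) * ∑ h ∈ Ico 1 P, geomBound M (h * α)
        ≤ L * (16 * N / R) + (1 + Real.log M) * (16 * (N / M) * (1 + Real.log M)) := by
      have hA0 : 0 ≤ 1 + Real.log ⌊x⌋₊ := by linarith
      have hAL : 1 + Real.log ⌊x⌋₊ ≤ L := by linarith
      have hAM : 1 + Real.log ⌊x⌋₊ ≤ 1 + Real.log M := by linarith
      calc _ ≤ (1 + Real.log ⌊x⌋₊) * (16 * N / q + 16 * P * Real.log (1 + M)) :=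
            mul_le_mul_of_nonneg_left h2 hA0
        _ = (1 + Real.log ⌊x⌋₊) * (16 * N / q)
            + (1 + Real.log ⌊x⌋₊) * (16 * (N / M) * Real.log (1 + M)) := by
          rw [hPNM]; ring
        _ ≤ _ := by
          refine add_le_add (mul_le_mul hAL (by gcongr) (by positivity) (by linarith))
            (mul_le_mul hAM (by gcongr) (by positivity) (by linarith))
    have h6 : L * (16 * N / R) + (1 + Real.log M) * (16 * (N / M) * (1 + Real.log M))
        + (4 * N / M + 4 * N / R)
        ≤ N * (5 * L ^ 2 / R + 20 * (1 + Real.log M) ^ 2 / M) := by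
      have : N * (5 * L ^ 2 / R + 20 * (1 + Real.log M) ^ 2 / M)
          - (L * (16 * N / R) + (1 + Real.log M) * (16 * (N / M) * (1 + Real.log M))
            + (4 * N / M + 4 * N / R))
          = N / R * (5 * L ^ 2 - 16 * L - 4)
            + N / M * (4 * ((1 + Real.log M) ^ 2 - 1)) := by ring
      have h10 : 0 ≤ N / R * (5 * L ^ 2 - 16 * L - 4) := by
        apply mul_nonneg (by positivity)
        linarith
      have h11 : 0 ≤ N / M * (4 * ((1 + Real.log M) ^ 2 - 1)) := by
        refine mul_nonneg (by positivity) (mul_nonneg (by norm_num) (sub_nonneg.2 ?_))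
        exact one_le_pow₀ (by linarith)
      linarith only [this, h10, h11]
    linarith only [h1, h3, h4, h5, h6]

/-- `(1 + log x) / √x`. -/
noncomputable def logDivSqrt (x : ℝ) : ℝ := (1 + Real.log x) / √x

lemma logDivSqrt_nonneg {x : ℝ} (hx : 1 ≤ x) : 0 ≤ logDivSqrt x := by
  have := Real.log_nonneg hx
  unfold logDivSqrt
  positivity

lemma norm_bilinear_le {a : ℤ} {q N P : ℕ} {α R B : ℝ} (haq : IsCoprime a (q : ℤ))
    (hα : |α - (a : ℝ) / (q : ℝ)| ≤ 1 / (q : ℝ) ^ 2) (hR : 1 ≤ R) (hL : 17 ≤ Real.log (4 * R))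
    (hRq : R ≤ q) (hqN : (q : ℝ) ≤ N / R) (hP : 1 ≤ P) (hPN : P ≤ N) (hB : 0 ≤ B)
    {f : ℕ → ℂ} (hf : ∀ n, ‖f n‖ ≤ B) :
    ‖∑ p ∈ Ioc P (P + P) with p.Prime, ∑ m ∈ Icc 1 (N / p),
        f p * f m * Real.log p * e (m * (p * α))‖
      ≤ B ^ 2 * N * (2 * logDivSqrt P + 160 * Real.log (4 * R) / √R
        + 320 * logDivSqrt (N / P)) := by
  have hP' : (1 : ℝ) ≤ P := by exact_mod_cast hP
  have hPN' : (P : ℝ) ≤ N := by exact_mod_cast hPN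
  have hN' : (0 : ℝ) < N := by linarith
  have h1 := norm_bilinear_sq_le (α := α) hP hPN hB hf
  have h2 := sum_weighted_geomBound_le haq hα hR hL hRq hqN hP hPN
  have hM1 : 1 ≤ (N : ℝ) / P := by rw [one_le_div (by linarith)]; exact hPN'
  set M : ℝ := (N : ℝ) / P with hMdef
  set L := Real.log (4 * R) with hLdef
  have hR0 : 0 < R := by linarith
  have hM0 : 0 < M := by linarith
  have hA := logDivSqrt_nonneg hP'
  have hC := logDivSqrt_nonneg hM1
  have hlogP : Real.log (2 * P) ≤ 1 + Real.log P := by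
    rw [Real.log_mul (by norm_num) (by linarith)]
    linarith [Real.log_two_lt_d9]
  have hlogP0 : 0 ≤ Real.log (2 * P) := Real.log_nonneg (by linarith)
  have hsqA : 2 * (N / P) * Real.log (2 * P) ^ 2 ≤ N * (2 * logDivSqrt P) ^ 2 := by
    have : N * (2 * logDivSqrt P) ^ 2 = 4 * (N / P) * (1 + Real.log P) ^ 2 := by
      unfold logDivSqrt
      rw [mul_pow, div_pow, Real.sq_sqrt (by linarith)]
      ring
    rw [this]
    gcongr
    norm_num
  -- The constants come from `160² = 5120 · 5` and, below, `320² = 5120 · 20`.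
  have hsqB : (160 * L / √R) ^ 2 = 5120 * (5 * L ^ 2 / R) := by
    rw [div_pow, Real.sq_sqrt hR0.le]; ring
  have hsqC : (320 * logDivSqrt M) ^ 2 = 5120 * (20 * (1 + Real.log M) ^ 2 / M) := by
    unfold logDivSqrt
    rw [mul_pow, div_pow, Real.sq_sqrt hM0.le]; ring
  have hBt : 0 ≤ 160 * L / √R := by positivity
  refine le_of_sq_le_sq (h1.trans ?_) (by positivity)
  calc _ ≤ B ^ 4 * N * (N * (2 * logDivSqrt P) ^ 2
        + 5120 * (N * (5 * L ^ 2 / R + 20 * (1 + Real.log M) ^ 2 / M))) := by gcongr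
    _ = (B ^ 2 * N) ^ 2 * ((2 * logDivSqrt P) ^ 2 + (160 * L / √R) ^ 2
        + (320 * logDivSqrt M) ^ 2) := by rw [hsqB, hsqC]; ring
    _ ≤ (B ^ 2 * N) ^ 2 * (2 * logDivSqrt P + 160 * L / √R + 320 * logDivSqrt M) ^ 2 := by
        gcongr
        nlinarith [mul_nonneg hA hBt, mul_nonneg hA hC, mul_nonneg hBt hC]
    _ = _ := by ring

/-! ### Summation over dyadic ranges -/

/-- A function whose dyadic differences majorize `logDivSqrt`. -/
noncomputable def logDivSqrtPrim (x : ℝ) : ℝ := (19 / 2 + 7 / 2 * Real.log x) / √x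

/-- The coefficients solve `B(1 - 1/√2) ≥ 1` and `A(1 - 1/√2) - B (log 2)/√2 ≥ 1`, with `B = 7/2`
and `A = 19/2`. The dyadic sums then telescope. -/
lemma logDivSqrt_le_sub {x : ℝ} (hx : 1 ≤ x) :
    logDivSqrt x ≤ logDivSqrtPrim x - logDivSqrtPrim (2 * x) := by
  have hlog := Real.log_nonneg hx
  have hsx : 0 < √x := Real.sqrt_pos.2 (by linarith)
  have h2 : (0 : ℝ) < √2 := by positivity
  have hsq : √2 * √2 = 2 := Real.mul_self_sqrt (by norm_num)
  unfold logDivSqrt logDivSqrtPrim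
  rw [Real.sqrt_mul (by norm_num), Real.log_mul (by norm_num) (by linarith)]
  have hl2 := Real.log_two_lt_d9
  have hl20 := Real.log_two_gt_d9
  have h5 : (1.414 : ℝ) < √2 := Real.lt_sqrt_of_sq_lt (by norm_num)
  have hinv : (1 : ℝ) / √2 ≤ 0.7073 := by
    rw [div_le_iff₀ h2]
    linarith
  have h6 : (19 / 2 + 7 / 2 * (Real.log 2 + Real.log x)) / (√2 * √x)
      = (19 / 2 + 7 / 2 * (Real.log 2 + Real.log x)) * (1 / √2) / √x := by
    field_simp
  rw [h6, ← sub_div]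
  gcongr
  have h7 : (19 / 2 + 7 / 2 * (Real.log 2 + Real.log x)) * (1 / √2)
      ≤ (19 / 2 + 7 / 2 * (Real.log 2 + Real.log x)) * 0.7073 := by
    gcongr
  linarith

lemma logDivSqrtPrim_nonneg {x : ℝ} (hx : 1 ≤ x) : 0 ≤ logDivSqrtPrim x := by
  have := Real.log_nonneg hx
  unfold logDivSqrtPrim
  positivity

lemma logDivSqrtPrim_le {x : ℝ} (hx : 1 ≤ x) : logDivSqrtPrim x ≤ 19 / 2 := by
  have hsx : 1 ≤ √x := Real.one_le_sqrt.2 hx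
  have h1 : Real.log x = 2 * Real.log √x := by
    rw [Real.log_sqrt (by linarith)]; ring
  have h2 := Real.log_le_sub_one_of_pos (by linarith : 0 < √x)
  unfold logDivSqrtPrim
  rw [div_le_iff₀ (by linarith), h1]
  linarith

lemma sum_logDivSqrt_two_pow_le (J : ℕ) :
    ∑ j ∈ range J, logDivSqrt ((2 ^ j : ℕ) : ℝ) ≤ 19 / 2 := by
  have h : ∑ j ∈ range J, logDivSqrt ((2 ^ j : ℕ) : ℝ)
      ≤ ∑ j ∈ range J, (logDivSqrtPrim ((2 : ℝ) ^ j) - logDivSqrtPrim ((2 : ℝ) ^ (j + 1))) := by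
    refine sum_le_sum fun j _ => ?_
    have := logDivSqrt_le_sub (x := 2 ^ j) (one_le_pow₀ (by norm_num))
    rw [pow_succ, mul_comm ((2 : ℝ) ^ j) 2]
    push_cast
    exact this
  rw [sum_range_sub' fun j => logDivSqrtPrim ((2 : ℝ) ^ j)] at h
  have h1 := logDivSqrtPrim_nonneg (x := (2 : ℝ) ^ J) (one_le_pow₀ (by norm_num))
  have h2 := logDivSqrtPrim_le (x := (2 : ℝ) ^ 0) (by norm_num)
  exact h.trans ((sub_le_self _ h1).trans h2)

lemma sum_logDivSqrt_div_two_pow_le {N J : ℕ} (hJ : 2 ^ J ≤ N) :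
    ∑ j ∈ range (J + 1), logDivSqrt ((N : ℝ) / ((2 ^ j : ℕ) : ℝ)) ≤ 19 / 2 := by
  have hpow : ∀ j ≤ J, (1 : ℝ) ≤ N / 2 ^ j := by
    intro j hj
    rw [one_le_div (by positivity)]
    exact_mod_cast (Nat.pow_le_pow_right (by norm_num) hj).trans hJ
  have h : ∑ j ∈ range (J + 1), logDivSqrt ((N : ℝ) / ((2 ^ j : ℕ) : ℝ))
      ≤ ∑ j ∈ range (J + 1), (logDivSqrtPrim (2 * N / 2 ^ (j + 1))
        - logDivSqrtPrim (2 * N / 2 ^ j)) := by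
    refine sum_le_sum fun j hj => ?_
    have := logDivSqrt_le_sub (hpow j (by have := mem_range.1 hj; omega))
    have h1 : (2 : ℝ) * N / 2 ^ (j + 1) = N / 2 ^ j := by rw [pow_succ]; field_simp
    have h2 : (2 : ℝ) * N / 2 ^ j = 2 * (N / 2 ^ j) := by ring
    rw [h1, h2]
    push_cast
    exact this
  rw [sum_range_sub (fun j => logDivSqrtPrim (2 * N / 2 ^ j))] at h
  have h0 := hpow 0 (Nat.zero_le _)
  have h1 := logDivSqrtPrim_nonneg (x := 2 * N / 2 ^ 0) (by
    have : (2 : ℝ) * N / 2 ^ 0 = 2 * (N / 2 ^ 0) := by ring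
    linarith)
  have h2 := logDivSqrtPrim_le (x := 2 * N / 2 ^ (J + 1)) (by
    have h1 : (2 : ℝ) * N / 2 ^ (J + 1) = N / 2 ^ J := by rw [pow_succ]; field_simp
    rw [h1]
    exact hpow J le_rfl)
  linarith

lemma sum_Ioc_one_two_pow (g : ℕ → ℂ) (J : ℕ) :
    ∑ p ∈ Ioc 1 (2 ^ J) with p.Prime, g p
      = ∑ j ∈ range J, ∑ p ∈ Ioc (2 ^ j) (2 ^ j + 2 ^ j) with p.Prime, g p := by
  induction J with
  | zero => simp
  | succ J ih =>
    rw [sum_range_succ, ← ih]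
    simp only [sum_filter]
    have h : (2 : ℕ) ^ (J + 1) = 2 ^ J + 2 ^ J := by ring
    rw [h, sum_Ioc_consecutive _ Nat.one_le_two_pow (Nat.le_add_left _ _)]

/-- The bilinear sum over all primes. -/
lemma norm_bilinear_total_le {a : ℤ} {q N : ℕ} {α R B : ℝ} (haq : IsCoprime a (q : ℤ))
    (hα : |α - (a : ℝ) / (q : ℝ)| ≤ 1 / (q : ℝ) ^ 2) (hR : 1 ≤ R) (hL : 17 ≤ Real.log (4 * R))
    (hRq : R ≤ q) (hqN : (q : ℝ) ≤ N / R) (hN : 1 ≤ N) (hB : 0 ≤ B)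
    {f : ℕ → ℂ} (hf : ∀ n, ‖f n‖ ≤ B) :
    ‖∑ p ∈ Icc 1 N with p.Prime, ∑ m ∈ Icc 1 (N / p),
        f p * f m * Real.log p * e (m * (p * α))‖
      ≤ B ^ 2 * N * (3059 + (Real.log N / Real.log 2 + 1) * (160 * Real.log (4 * R) / √R)) := by
  set g : ℕ → ℂ := fun p => ∑ m ∈ Icc 1 (N / p), f p * f m * Real.log p * e (m * (p * α)) with hg
  set J := Nat.log 2 N with hJ
  have hJN : 2 ^ J ≤ N := Nat.pow_log_le_self 2 (by omega)
  have hNJ : N < 2 ^ (J + 1) := Nat.lt_pow_succ_log_self (by norm_num) N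
  -- Primes beyond `N` have an empty inner sum, so the range can be extended to a power of two.
  have h1 : ∑ p ∈ Icc 1 N with p.Prime, g p = ∑ p ∈ Ioc 1 (2 ^ (J + 1)) with p.Prime, g p := by
    refine sum_subset ?_ ?_
    · intro p hp
      obtain ⟨h1, h2⟩ := mem_filter.1 hp
      have h3 := (mem_Icc.1 h1).2
      exact mem_filter.2 ⟨mem_Ioc.2 ⟨h2.one_lt, by omega⟩, h2⟩
    · intro p hp hp'
      obtain ⟨h1, h2⟩ := mem_filter.1 hp
      have h3 : N < p := by
        by_contra hcon
        exact hp' (mem_filter.2 ⟨mem_Icc.2 ⟨h2.one_lt.le, not_lt.1 hcon⟩, h2⟩)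
      simp [hg, Nat.div_eq_of_lt h3]
  rw [h1, sum_Ioc_one_two_pow]
  have hJlog : ((J + 1 : ℕ) : ℝ) ≤ Real.log N / Real.log 2 + 1 := by
    have h2 := Real.natLog_le_logb N 2
    rw [Real.logb] at h2
    push_cast at h2 ⊢
    linarith
  have hR0 : 0 < R := by linarith
  calc _ ≤ ∑ j ∈ range (J + 1), B ^ 2 * N * (2 * logDivSqrt ((2 ^ j : ℕ) : ℝ)
          + 160 * Real.log (4 * R) / √R + 320 * logDivSqrt (N / ((2 ^ j : ℕ) : ℝ))) := by
        refine (norm_sum_le _ _).trans (sum_le_sum fun j hj => ?_)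
        refine norm_bilinear_le haq hα hR hL hRq hqN Nat.one_le_two_pow ?_ hB hf
        have := mem_range.1 hj
        exact (Nat.pow_le_pow_right (by norm_num) (by omega)).trans hJN
    _ = B ^ 2 * N * (2 * ∑ j ∈ range (J + 1), logDivSqrt ((2 ^ j : ℕ) : ℝ)
          + ((J + 1 : ℕ) : ℝ) * (160 * Real.log (4 * R) / √R)
          + 320 * ∑ j ∈ range (J + 1), logDivSqrt (N / ((2 ^ j : ℕ) : ℝ))) := by
        rw [← mul_sum, sum_add_distrib, sum_add_distrib, ← mul_sum, ← mul_sum, sum_const,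
          card_range, nsmul_eq_mul]
    _ ≤ B ^ 2 * N * (2 * (19 / 2)
          + (Real.log N / Real.log 2 + 1) * (160 * Real.log (4 * R) / √R) + 320 * (19 / 2)) := by
        gcongr
        · exact sum_logDivSqrt_two_pow_le _
        · exact sum_logDivSqrt_div_two_pow_le hJN
    _ = _ := by ring

/-! ### Passing from `f` to the bilinear sum over primes -/

lemma sum_filter_dvd {β : Type*} [AddCommMonoid β] (F : ℕ → β) {N d : ℕ} (hd : 0 < d) :
    ∑ n ∈ Icc 1 N with d ∣ n, F n = ∑ m ∈ Icc 1 (N / d), F (d * m) := by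
  symm
  refine sum_nbij' (fun m => d * m) (fun n => n / d) ?_ ?_ ?_ ?_ fun _ _ => rfl
  · intro m hm
    obtain ⟨h1, h2⟩ := mem_Icc.1 hm
    refine mem_filter.2 ⟨mem_Icc.2 ⟨Nat.mul_pos hd h1, ?_⟩, dvd_mul_right d m⟩
    rw [mul_comm]
    exact (Nat.le_div_iff_mul_le hd).1 h2
  · intro n hn
    obtain ⟨h1, h2⟩ := mem_filter.1 hn
    obtain ⟨h3, h4⟩ := mem_Icc.1 h1
    exact mem_Icc.2 ⟨Nat.div_pos (Nat.le_of_dvd h3 h2) hd, Nat.div_le_div_right h4⟩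
  · intro m _
    exact Nat.mul_div_cancel_left m hd
  · intro n hn
    exact Nat.mul_div_cancel' (mem_filter.1 hn).2

lemma card_filter_dvd_le (N : ℕ) {d : ℕ} (hd : 0 < d) :
    (#{n ∈ Icc 1 N | d ∣ n} : ℝ) ≤ N / d := by
  have h := sum_filter_dvd (fun _ => 1) (N := N) hd
  simp only [sum_const, smul_eq_mul, mul_one, Nat.card_Icc, Nat.add_sub_cancel] at h
  rw [h]
  exact Nat.cast_div_le

/-- `∑_{p ∣ n} log p`. -/
noncomputable def logRadical (n : ℕ) : ℝ := ∑ p ∈ n.primeFactors, Real.log p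

lemma primeFactors_eq_filter {n N : ℕ} (hn : n ∈ Icc 1 N) :
    n.primeFactors = {p ∈ {p ∈ Icc 1 N | p.Prime} | p ∣ n} := by
  obtain ⟨h1, h2⟩ := mem_Icc.1 hn
  ext p
  simp only [Nat.mem_primeFactors, mem_filter, mem_Icc]
  constructor
  · rintro ⟨h3, h4, -⟩
    exact ⟨⟨⟨h3.one_lt.le, (Nat.le_of_dvd h1 h4).trans h2⟩, h3⟩, h4⟩
  · rintro ⟨⟨-, h3⟩, h4⟩
    exact ⟨h3, h4, by omega⟩

lemma sum_mul_logRadical (F : ℕ → ℂ) (N : ℕ) :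
    ∑ n ∈ Icc 1 N, F n * logRadical n
      = ∑ p ∈ Icc 1 N with p.Prime, ∑ m ∈ Icc 1 (N / p), F (p * m) * Real.log p := by
  have h1 : ∀ n ∈ Icc 1 N, F n * logRadical n
      = ∑ p ∈ Icc 1 N with p.Prime, if p ∣ n then F n * Real.log p else 0 := by
    intro n hn
    rw [logRadical, primeFactors_eq_filter hn, ← sum_filter]
    push_cast
    rw [mul_sum]
  rw [sum_congr rfl h1, sum_comm]
  refine sum_congr rfl fun p hp => ?_
  rw [← sum_filter]
  exact sum_filter_dvd (fun n => F n * (Real.log p : ℂ)) (mem_filter.1 hp).2.pos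

/-- The left side is `log(N^N / N!)`, and `N^N / N!` is a term of the series for `exp N`. -/
lemma sum_log_sub_log_le (N : ℕ) : ∑ n ∈ Icc 1 N, (Real.log N - Real.log n) ≤ N := by
  rcases Nat.eq_zero_or_pos N with rfl | hN
  · simp
  have hN' : (0 : ℝ) < N := by exact_mod_cast hN
  have h1 : ∑ n ∈ Icc 1 N, Real.log n = Real.log (N.factorial) := by
    rw [← Real.log_prod fun n hn => by have := (mem_Icc.1 hn).1; positivity]
    rw [← prod_range_add_one_eq_factorial, show Icc 1 N = Ico 1 (N + 1) by ext; simp,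
      prod_Ico_eq_prod_range]
    push_cast
    simp [add_comm]
  have h2 := Real.pow_div_factorial_le_exp (N : ℝ) hN'.le N
  have hf : (0 : ℝ) < N.factorial := by exact_mod_cast N.factorial_pos
  have h3 := Real.log_le_log (by positivity) h2
  rw [Real.log_div (by positivity) hf.ne', Real.log_pow, Real.log_exp] at h3
  rw [sum_sub_distrib, h1, sum_const, Nat.card_Icc, nsmul_eq_mul]
  simpa using h3

lemma sum_log_div_sq_le (N : ℕ) : ∑ n ∈ Icc 1 N, Real.log n / (n : ℝ) ^ 2 ≤ 2 := by
  have key : ∀ N : ℕ, ∑ n ∈ Icc 1 (N + 1), Real.log n / (n : ℝ) ^ 2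
      ≤ 2 - (Real.log ((N : ℝ) + 1) + 2) / ((N : ℝ) + 1) := by
    intro N
    induction N with
    | zero => norm_num
    | succ N ih =>
      rw [sum_Icc_succ_top (by omega)]
      push_cast at ih ⊢
      set x : ℝ := (N : ℝ) + 1 with hx
      have hx1 : 1 ≤ x := by rw [hx]; linarith [Nat.cast_nonneg (α := ℝ) N]
      have hx0 : 0 < x := by linarith
      have h1 : Real.log (x + 1) - 1 / x ≤ Real.log x := by
        have h2 := Real.log_le_sub_one_of_pos (by positivity : 0 < (x + 1) / x)
        rw [Real.log_div (by positivity) hx0.ne'] at h2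
        have h3 : (x + 1) / x - 1 = 1 / x := by field_simp; ring
        linarith
      have hl : 0 ≤ Real.log (x + 1) := Real.log_nonneg (by linarith)
      set l := Real.log (x + 1)
      have h4 : (l - 1 / x + 2) / x ≤ (Real.log x + 2) / x := by gcongr
      have h5 : l / (x + 1) ^ 2 + (l + 2) / (x + 1) ≤ (l - 1 / x + 2) / x := by
        have h6 : (l - 1 / x + 2) / x - (l / (x + 1) ^ 2 + (l + 2) / (x + 1))
            = (l * x + (x + 1) * (x - 1)) / (x ^ 2 * (x + 1) ^ 2) := by
          field_simp
          ring
        have h7 : 0 ≤ (l * x + (x + 1) * (x - 1)) / (x ^ 2 * (x + 1) ^ 2) := by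
          have : 0 ≤ x - 1 := by linarith
          positivity
        linarith
      linarith
  rcases N with _ | N
  · simp
  · have h0 := key N
    have h1 : 0 ≤ Real.log ((N : ℝ) + 1) := Real.log_nonneg (by linarith [Nat.cast_nonneg (α := ℝ) N])
    have : 0 ≤ (Real.log ((N : ℝ) + 1) + 2) / ((N : ℝ) + 1) := by positivity
    linarith

lemma sum_prime_log_div_sq_le (N : ℕ) :
    ∑ p ∈ Icc 1 N with p.Prime, Real.log p / (p : ℝ) ^ 2 ≤ 2 := by
  refine le_trans (sum_le_sum_of_subset_of_nonneg (filter_subset _ _) fun p _ _ => ?_)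
    (sum_log_div_sq_le N)
  have := Real.log_natCast_nonneg p
  positivity

lemma sum_pow_Icc_two_le {x : ℝ} (hx0 : 0 ≤ x) (hx : x ≤ 1 / 2) (K : ℕ) :
    ∑ k ∈ Icc 2 K, x ^ k ≤ 2 * x ^ 2 := by
  have key : ∀ K : ℕ, ∑ k ∈ Icc 2 (K + 2), x ^ k + x ^ (K + 2) ≤ 2 * x ^ 2 := by
    intro K
    induction K with
    | zero => simp; linarith
    | succ K ih =>
      rw [sum_Icc_succ_top (by omega)]
      have : x ^ (K + 1 + 2) = x * x ^ (K + 2) := by ring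
      have h1 : (0 : ℝ) ≤ x ^ (K + 2) := by positivity
      have h2 : x ^ (K + 1 + 1 + 1) = x * x ^ (K + 2) := by ring
      rw [show K + 1 + 2 = K + 2 + 1 by ring] at *
      nlinarith
  rcases lt_or_ge K 2 with h | h
  · rw [Icc_eq_empty (by omega), sum_empty]; positivity
  · obtain ⟨k, rfl⟩ := Nat.exists_eq_add_of_le' h
    have := key k
    have h1 : (0 : ℝ) ≤ x ^ (k + 2) := by positivity
    linarith

open ArithmeticFunction in
-- Only prime powers `p^k` with `k ≥ 2` count. For each `p` the geometric series is at most `2/p²`,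
-- and `∑ (log p)/p² ≤ 2`.
lemma sum_vonMangoldt_div_not_prime_le (N : ℕ) :
    ∑ d ∈ Icc 1 N with ¬ d.Prime, vonMangoldt d / (d : ℝ) ≤ 4 := by
  classical
  have h1 : ∑ d ∈ Icc 1 N with ¬ d.Prime, vonMangoldt d / (d : ℝ)
      = ∑ d ∈ {d ∈ Icc 1 N | ¬ d.Prime} with IsPrimePow d, vonMangoldt d / (d : ℝ) := by
    symm
    refine sum_subset (filter_subset _ _) fun d hd hd' => ?_
    have : ¬ IsPrimePow d := fun h => hd' (mem_filter.2 ⟨hd, h⟩)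
    rw [vonMangoldt_apply, if_neg this, zero_div]
  have h2 : ∑ d ∈ {d ∈ Icc 1 N | ¬ d.Prime} with IsPrimePow d, vonMangoldt d / (d : ℝ)
      ≤ ∑ x ∈ {p ∈ Icc 1 N | p.Prime} ×ˢ Icc 2 N, Real.log x.1 * (1 / (x.1 : ℝ)) ^ x.2 := by
    refine sum_le_sum_of_exists (fun x => x.1 ^ x.2) (fun x _ => ?_) fun d hd => ?_
    · have := Real.log_natCast_nonneg x.1
      positivity
    · obtain ⟨hd1, hd2⟩ := mem_filter.1 hd
      obtain ⟨hd3, hd4⟩ := mem_filter.1 hd1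
      obtain ⟨-, hd5⟩ := mem_Icc.1 hd3
      obtain ⟨p, k, hp, hk, rfl⟩ := (isPrimePow_nat_iff d).1 hd2
      have hk2 : 2 ≤ k := by
        by_contra hcon
        have : k = 1 := by omega
        subst this
        simp [hp] at hd4
      have hkN : k ≤ N := (Nat.lt_pow_self hp.one_lt).le.trans hd5
      have hpN : p ≤ N := (Nat.le_self_pow (by omega) p).trans hd5
      refine ⟨(p, k), mem_product.2 ⟨mem_filter.2 ⟨mem_Icc.2 ⟨hp.one_lt.le, hpN⟩, hp⟩,
        mem_Icc.2 ⟨hk2, hkN⟩⟩, rfl, ?_⟩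
      rw [vonMangoldt_apply_pow (by omega), vonMangoldt_apply_prime hp]
      push_cast
      rw [one_div, inv_pow, div_eq_mul_inv]
  rw [h1]
  refine h2.trans ?_
  rw [sum_product' (f := fun p k : ℕ => Real.log p * (1 / (p : ℝ)) ^ k)]
  calc _ ≤ ∑ p ∈ Icc 1 N with p.Prime, 2 * (Real.log p / (p : ℝ) ^ 2) := by
        refine sum_le_sum fun p hp => ?_
        have hp2 : (2 : ℝ) ≤ p := by exact_mod_cast (mem_filter.1 hp).2.two_le
        rw [← mul_sum]
        have h3 := sum_pow_Icc_two_le (x := 1 / (p : ℝ)) (by positivity)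
          (one_div_le_one_div_of_le (by norm_num) hp2) N
        calc _ ≤ Real.log p * (2 * (1 / (p : ℝ)) ^ 2) :=
              mul_le_mul_of_nonneg_left h3 (Real.log_natCast_nonneg p)
          _ = _ := by rw [one_div, inv_pow]; ring
    _ ≤ 4 := by
        rw [← mul_sum]
        linarith [sum_prime_log_div_sq_le N]

open ArithmeticFunction in
lemma log_sub_logRadical {n N : ℕ} (hn : n ∈ Icc 1 N) :
    Real.log n - logRadical n
      = ∑ d ∈ Icc 1 N with ¬ d.Prime, if d ∣ n then vonMangoldt d else 0 := by
  obtain ⟨h1, h2⟩ := mem_Icc.1 hn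
  have h3 : n.divisors = {d ∈ Icc 1 N | d ∣ n} := by
    ext d
    simp only [Nat.mem_divisors, mem_filter, mem_Icc]
    refine ⟨fun ⟨h3, _⟩ => ⟨⟨Nat.pos_of_dvd_of_pos h3 h1, (Nat.le_of_dvd h1 h3).trans h2⟩, h3⟩,
      fun h3 => ⟨h3.2, by omega⟩⟩
  have h4 : Real.log n = ∑ d ∈ Icc 1 N, if d ∣ n then vonMangoldt d else 0 := by
    rw [← vonMangoldt_sum, h3, sum_filter]
  have h5 : logRadical n
      = ∑ d ∈ Icc 1 N with d.Prime, if d ∣ n then vonMangoldt d else 0 := by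
    rw [logRadical, primeFactors_eq_filter hn, sum_filter]
    refine sum_congr rfl fun p hp => ?_
    rw [vonMangoldt_apply_prime (mem_filter.1 hp).2]
  rw [h4, h5, ← sum_filter_add_sum_filter_not (Icc 1 N) Nat.Prime]
  ring

open ArithmeticFunction in
lemma sum_log_sub_logRadical_le (N : ℕ) :
    ∑ n ∈ Icc 1 N, (Real.log n - logRadical n) ≤ 4 * N := by
  rw [sum_congr rfl fun n hn => log_sub_logRadical hn, sum_comm]
  calc _ ≤ ∑ d ∈ Icc 1 N with ¬ d.Prime, N * (vonMangoldt d / (d : ℝ)) := by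
        refine sum_le_sum fun d hd => ?_
        have hd0 := (mem_Icc.1 (mem_filter.1 hd).1).1
        rw [← sum_filter, sum_const, nsmul_eq_mul]
        calc _ ≤ (N : ℝ) / d * vonMangoldt d :=
              mul_le_mul_of_nonneg_right (card_filter_dvd_le N hd0) vonMangoldt_nonneg
          _ = _ := by ring
    _ ≤ 4 * N := by
        rw [← mul_sum, mul_comm]
        exact mul_le_mul_of_nonneg_right (sum_vonMangoldt_div_not_prime_le N) (Nat.cast_nonneg N)

open ArithmeticFunction in
lemma logRadical_le {n : ℕ} (hn : 1 ≤ n) : logRadical n ≤ Real.log n := by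
  have h := log_sub_logRadical (mem_Icc.2 ⟨hn, le_rfl⟩)
  have h1 : 0 ≤ ∑ d ∈ Icc 1 n with ¬ d.Prime, if d ∣ n then vonMangoldt d else 0 :=
    sum_nonneg fun d _ => by
      split_ifs
      · exact vonMangoldt_nonneg
      · exact le_rfl
  linarith

/-- Multiplicativity makes the defect vanish unless `p ∣ m`. There are at most `N/p²` such `m`, each
with defect at most `B + B² ≤ 2B²`. -/
lemma norm_sum_defect_le {B α : ℝ} (hB : 1 ≤ B) {f : ArithmeticFunction ℂ}
    (hf : BoundedMultiplicative B f) (N : ℕ) :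
    ‖∑ p ∈ Icc 1 N with p.Prime, ∑ m ∈ Icc 1 (N / p),
        (f (p * m) - f p * f m) * Real.log p * e (m * (p * α))‖ ≤ 4 * B ^ 2 * N := by
  calc _ ≤ ∑ p ∈ Icc 1 N with p.Prime, 2 * B ^ 2 * N * (Real.log p / (p : ℝ) ^ 2) := by
        refine (norm_sum_le _ _).trans (sum_le_sum fun p hp => ?_)
        have hpp := (mem_filter.1 hp).2
        have hlog := Real.log_natCast_nonneg p
        have hp0 : (0 : ℝ) < p := by exact_mod_cast hpp.pos
        calc _ ≤ ∑ m ∈ Icc 1 (N / p), if p ∣ m then 2 * B ^ 2 * Real.log p else 0 := by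
              refine (norm_sum_le _ _).trans (sum_le_sum fun m _ => ?_)
              rw [norm_mul, norm_e, mul_one, norm_mul, Complex.norm_real,
                Real.norm_of_nonneg hlog]
              split_ifs with h
              · gcongr
                refine (norm_sub_le _ _).trans ?_
                rw [norm_mul]
                have h1 := hf.2 (p * m)
                have h2 : ‖f p‖ * ‖f m‖ ≤ B * B := by
                  have := hf.2 p
                  have := hf.2 m
                  gcongr
                nlinarith
              · have hc : Nat.Coprime p m := (Nat.Prime.coprime_iff_not_dvd hpp).2 h
                rw [hf.1.map_mul_of_coprime hc, sub_self, norm_zero, zero_mul]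
          _ = #{m ∈ Icc 1 (N / p) | p ∣ m} * (2 * B ^ 2 * Real.log p) := by
              rw [← sum_filter, sum_const, nsmul_eq_mul]
          _ ≤ (N / p) / p * (2 * B ^ 2 * Real.log p) := by
              gcongr
              refine (card_filter_dvd_le _ hpp.pos).trans ?_
              gcongr
              exact Nat.cast_div_le
          _ = _ := by field_simp
    _ ≤ 4 * B ^ 2 * N := by
        rw [← mul_sum]
        have := mul_le_mul_of_nonneg_left (sum_prime_log_div_sq_le N)
          (by positivity : 0 ≤ 2 * B ^ 2 * (N : ℝ))
        linarith

lemma norm_S_mul_log_le {B α : ℝ} (hB : 1 ≤ B) {f : ArithmeticFunction ℂ}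
    (hf : BoundedMultiplicative B f) (N : ℕ) :
    ‖S f N α‖ * Real.log N ≤ 9 * B ^ 2 * N
      + ‖∑ p ∈ Icc 1 N with p.Prime, ∑ m ∈ Icc 1 (N / p),
          f p * f m * Real.log p * e (m * (p * α))‖ := by
  set F : ℕ → ℂ := fun n => f n * e (n * α) with hF
  have hFB : ∀ n, ‖F n‖ ≤ B := by
    intro n
    rw [hF]
    simp only [norm_mul, norm_e, mul_one]
    exact hf.2 n
  have h1 : S f N α * Real.log N
      = ∑ n ∈ Icc 1 N, F n * ((Real.log N - Real.log n : ℝ) : ℂ)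
        + ∑ n ∈ Icc 1 N, F n * ((Real.log n - logRadical n : ℝ) : ℂ)
        + (∑ p ∈ Icc 1 N with p.Prime, ∑ m ∈ Icc 1 (N / p),
            (f (p * m) - f p * f m) * Real.log p * e (m * (p * α))
          + ∑ p ∈ Icc 1 N with p.Prime, ∑ m ∈ Icc 1 (N / p),
            f p * f m * Real.log p * e (m * (p * α))) := by
    have h2 := sum_mul_logRadical F N
    have h3 : ∑ p ∈ Icc 1 N with p.Prime, ∑ m ∈ Icc 1 (N / p), F (p * m) * Real.log p
        = ∑ p ∈ Icc 1 N with p.Prime, ∑ m ∈ Icc 1 (N / p),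
            (f (p * m) - f p * f m) * Real.log p * e (m * (p * α))
          + ∑ p ∈ Icc 1 N with p.Prime, ∑ m ∈ Icc 1 (N / p),
            f p * f m * Real.log p * e (m * (p * α)) := by
      rw [← sum_add_distrib]
      refine sum_congr rfl fun p _ => ?_
      rw [← sum_add_distrib]
      refine sum_congr rfl fun m _ => ?_
      simp only [hF]
      have : ((p * m : ℕ) : ℝ) * α = m * (p * α) := by push_cast; ring
      rw [this]
      ring
    rw [← h3, ← h2, ← sum_add_distrib, ← sum_add_distrib, S, sum_mul]
    refine sum_congr rfl fun n _ => ?_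
    simp only [hF]
    push_cast
    ring
  have hB2 : B ≤ B ^ 2 := by nlinarith
  have hN0 : (0 : ℝ) ≤ N := Nat.cast_nonneg N
  have hgen : ∀ w : ℕ → ℝ, (∀ n ∈ Icc 1 N, 0 ≤ w n) →
      ‖∑ n ∈ Icc 1 N, F n * (w n : ℂ)‖ ≤ B * ∑ n ∈ Icc 1 N, w n := by
    intro w hw
    rw [mul_sum]
    refine (norm_sum_le _ _).trans (sum_le_sum fun n hn => ?_)
    rw [norm_mul, Complex.norm_real, Real.norm_of_nonneg (hw n hn)]
    exact mul_le_mul_of_nonneg_right (hFB n) (hw n hn)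
  have hE1 := hgen (fun n => Real.log N - Real.log n) fun n hn => by
    obtain ⟨h2, h3⟩ := mem_Icc.1 hn
    have : (0 : ℝ) < n := by exact_mod_cast h2
    exact sub_nonneg.2 (Real.log_le_log this (by exact_mod_cast h3))
  have hE2 := hgen (fun n => Real.log n - logRadical n) fun n hn =>
    sub_nonneg.2 (logRadical_le (mem_Icc.1 hn).1)
  have hE3 := norm_sum_defect_le (α := α) hB hf N
  have hE1' : B * ∑ n ∈ Icc 1 N, (Real.log N - Real.log n) ≤ B ^ 2 * N :=
    mul_le_mul hB2 (sum_log_sub_log_le N) (sum_nonneg fun n hn => by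
      obtain ⟨h2, h3⟩ := mem_Icc.1 hn
      have : (0 : ℝ) < n := by exact_mod_cast h2
      exact sub_nonneg.2 (Real.log_le_log this (by exact_mod_cast h3))) (by positivity)
  have hE2' : B * ∑ n ∈ Icc 1 N, (Real.log n - logRadical n) ≤ B ^ 2 * (4 * N) :=
    mul_le_mul hB2 (sum_log_sub_logRadical_le N) (sum_nonneg fun n hn =>
      sub_nonneg.2 (logRadical_le (mem_Icc.1 hn).1)) (by positivity)
  have h4 : ‖S f N α‖ * Real.log N = ‖S f N α * Real.log N‖ := by
    rw [norm_mul, Complex.norm_real, Real.norm_of_nonneg (Real.log_natCast_nonneg N)]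
  rw [h4, h1]
  refine (norm_add_le _ _).trans ?_
  refine (add_le_add (norm_add_le _ _) (norm_add_le _ _)).trans ?_
  linarith

/-! ### Lower bounds for the constants -/

lemma one_le_tprod_oddPrimeFactor :
    1 ≤ ∏' p : {p : ℕ // p.Prime ∧ 2 < p}, oddPrimeFactor p := by
  refine ge_of_tendsto' multipliable_oddPrimeFactor.hasProd fun s => ?_
  refine Finset.one_le_prod fun p _ => ?_
  have h : (3 : ℝ) ≤ ((p : ℕ) : ℝ) := by exact_mod_cast p.2.2
  have h1 : 0 ≤ ((p : ℕ) : ℝ) ^ 3 - (p : ℝ) ^ 2 - 2 * (p : ℝ) := by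
    have : ((p : ℕ) : ℝ) ^ 3 - (p : ℝ) ^ 2 - 2 * (p : ℝ) = p * ((p - 2) * (p + 1)) := by ring
    rw [this]
    have : (0 : ℝ) ≤ ((p : ℕ) : ℝ) - 2 := by linarith
    positivity
  unfold oddPrimeFactor
  linarith [one_div_nonneg.2 h1]

lemma z_ge : 11.3 ≤ z := by
  have h1 := one_le_tprod_oddPrimeFactor
  have h2 : (1.4125 : ℝ) ≤ √(2 * ∏' p : {p : ℕ // p.Prime ∧ 2 < p}, oddPrimeFactor p) :=
    Real.le_sqrt_of_sq_le (by norm_num; linarith)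
  unfold z
  linarith

lemma c₁_ge {B E R : ℝ} (hB : 1 ≤ B) (hE : 4 ≤ E) (hR : 1 ≤ R) : 4000 * B ^ 2 ≤ c₁ B E R := by
  have hz := z_ge
  have hpi := Real.pi_gt_d2
  have hB2 : 1 ≤ B ^ 2 := one_le_pow₀ hB
  have hlog := Real.log_nonneg hR
  have h1 : 600 * B ^ 2 ≤ b₁ B E := by
    have h : b₁ B E = B + B ^ 2 * (9.82 + 8.12 * (1.59 + z) * E + 18.9 * 0.96 * z
        + 3.46 * 1.59 + 4.06 * z) := by
      unfold b₁ a₁ a₃ a₄; ring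
    rw [h]
    have : (600 : ℝ) ≤ 9.82 + 8.12 * (1.59 + z) * E + 18.9 * 0.96 * z
        + 3.46 * 1.59 + 4.06 * z := by
      nlinarith
    nlinarith
  have h2 : 0 ≤ B * (2 * Real.pi) * (2 * Real.log R / R ^ 2) := by positivity
  unfold c₁
  nlinarith

/-- The optimal constant is `2/e`, from the tangent to the logarithm at `e`. -/
lemma log_le_mul_sqrt {x : ℝ} (hx : 1 ≤ x) : Real.log x ≤ 0.74 * √x := by
  have hs : 0 < √x := Real.sqrt_pos.2 (by linarith)
  have h1 : Real.log x = 2 * Real.log √x := by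
    rw [Real.log_sqrt (by linarith)]; ring
  have he := Real.exp_pos 1
  have h2 := Real.log_le_sub_one_of_pos (by positivity : 0 < √x / Real.exp 1)
  rw [Real.log_div hs.ne' he.ne', Real.log_exp] at h2
  have h3 : √x / Real.exp 1 ≤ 0.37 * √x := by
    rw [div_le_iff₀ he]
    nlinarith [Real.exp_one_gt_d9]
  linarith

lemma rpow_three_halves {x : ℝ} (hx : 0 < x) : x ^ (3 / 2 : ℝ) = x * √x := by
  rw [Real.sqrt_eq_rpow, ← Real.rpow_one_add' hx.le (by norm_num)]
  norm_num

lemma log_four_lt : Real.log 4 < 1.4 := by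
  have : (4 : ℝ) = 2 ^ 2 := by norm_num
  rw [this, Real.log_pow]
  have := Real.log_two_lt_d9
  push_cast
  linarith

lemma b₃_ge {B E R q : ℝ} (hE : 4 ≤ E) (hER : 3 ≤ Real.log (E * R)) (hR : 1 ≤ R)
    (hq : 1 ≤ Real.log q) : 11 * B ^ 2 ≤ b₃ B E R q := by
  have hz := z_ge
  have hB2 : 0 ≤ B ^ 2 := sq_nonneg B
  set l := Real.log (E * R) with hl
  have hl0 : 0 < l := by linarith
  have hl32 : 1.7 * l ≤ l ^ (3 / 2 : ℝ) := by
    rw [rpow_three_halves hl0, mul_comm]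
    have : (1.7 : ℝ) ≤ √l := Real.le_sqrt_of_sq_le (by norm_num; linarith)
    gcongr
  have hl32' : 0 < l ^ (3 / 2 : ℝ) := by positivity
  have hlog2 : 0 < Real.log 2 := Real.log_pos (by norm_num)
  have hlog2R : 0 ≤ Real.log (2 * R) := Real.log_nonneg (by linarith)
  have hlogE : 0 ≤ Real.log E := Real.log_nonneg (by linarith)
  have hsE : 0 < √E := Real.sqrt_pos.2 (by linarith)
  have h4 : 0 ≤ a₅ B / Real.log 2 * (Real.log (2 * R) / l ^ (3 / 2 : ℝ)) := by
    have : 0 ≤ a₅ B := by unfold a₅; positivity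
    positivity
  have h6 : 0 ≤ a₆ B := by unfold a₆; positivity
  have h5 : 0 ≤ a₆ B / Real.log 2 * (1 / l ^ (3 / 2 : ℝ)) := by positivity
  have h3 : 0 ≤ 1.48 * (a₆ B / √l) := by positivity
  have h2 : 16 * B ^ 2 ≤ a₅ B * 1.48 := by
    unfold a₅
    nlinarith
  -- This term can be negative when `E` is large, because of `log(64/E)`. The factor `1/√E` limits
  -- the loss to `5 B²`, against the `16 B²` gained from `1.48 a₅`.
  have h1 : -(5 * B ^ 2) ≤ B ^ 2 * (7.63 / √E) * (Real.log (4 * E * R) / l ^ (3 / 2 : ℝ))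
      * (1 + (Real.log (64 / E) + 1) / Real.log q) := by
    have h7 : -Real.log E ≤ 1 + (Real.log (64 / E) + 1) / Real.log q := by
      have h64 : 0 ≤ Real.log 64 := Real.log_nonneg (by norm_num)
      rw [Real.log_div (by norm_num) (by linarith)]
      have : -Real.log E ≤ (Real.log 64 - Real.log E + 1) / Real.log q := by
        rw [le_div_iff₀ (by linarith)]
        nlinarith
      linarith
    have h8 : Real.log (4 * E * R) = Real.log 4 + l := by
      rw [mul_assoc, Real.log_mul (by norm_num) (by positivity)]
    have h9 : 0 ≤ Real.log 4 := Real.log_nonneg (by norm_num)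
    have h10 : Real.log (4 * E * R) / l ^ (3 / 2 : ℝ) ≤ 0.87 := by
      rw [h8, div_le_iff₀ hl32']
      linarith [log_four_lt]
    have h11 : 0 ≤ Real.log (4 * E * R) / l ^ (3 / 2 : ℝ) := by rw [h8]; positivity
    set X := Real.log (4 * E * R) / l ^ (3 / 2 : ℝ)
    have h12 := log_le_mul_sqrt (by linarith : 1 ≤ E)
    have h13 : 7.63 / √E * X * Real.log E ≤ 5 := by
      calc _ ≤ 7.63 / √E * 0.87 * (0.74 * √E) := by gcongr
        _ = 7.63 * 0.87 * 0.74 := by field_simp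
        _ ≤ 5 := by norm_num
    have h14 : 0 ≤ B ^ 2 * (7.63 / √E) * X := by positivity
    calc -(5 * B ^ 2) ≤ -(B ^ 2 * (7.63 / √E * X * Real.log E)) := by nlinarith
      _ = B ^ 2 * (7.63 / √E) * X * (-Real.log E) := by ring
      _ ≤ _ := mul_le_mul_of_nonneg_left h7 h14
  unfold b₃
  rw [← hl]
  linarith

lemma c₂_ge {B E R q : ℝ} (hE : 4 ≤ E) (hER : 3 ≤ Real.log (E * R)) (hR : Real.exp 1 < R)
    (hq : 1 ≤ Real.log q) : 80 * B ^ 2 ≤ c₂ B E R q := by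
  have hz := z_ge
  have hR1 : 1 ≤ R := by linarith [Real.add_one_le_exp 1]
  have h1 := b₃_ge (B := B) hE hER hR1 hq
  have hlR : 1 < Real.log R := by
    rw [Real.lt_log_iff_exp_lt (by linarith)]; exact hR
  have hllR : 0 < Real.log (Real.log R) := Real.log_pos hlR
  have hlog2 : 0 < Real.log 2 := Real.log_pos (by norm_num)
  have hb2 : 0 ≤ b₂ B E := by unfold b₂ a₂; positivity
  have h2 : 0 ≤ b₂ B E *
        ((Real.exp Real.eulerMascheroniConstant * Real.log (Real.log R)
            + 2.51 / Real.log (Real.log R)) ^ (1 / 2 : ℝ)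
          / Real.log (E * R) ^ (3 / 2 : ℝ)) := by positivity
  have hpi := Real.pi_gt_d2
  have hB2 : 0 ≤ B ^ 2 := sq_nonneg B
  unfold c₂
  calc 80 * B ^ 2 ≤ (1 + 2 * Real.pi) * (11 * B ^ 2) := by nlinarith
    _ ≤ _ := mul_le_mul_of_nonneg_left (by linarith) (by positivity)

/-- If `80 (log 4R)^{3/2} < √R` then `log 4R` is at least `17`. -/
lemma seventeen_le_log_of_lt {R : ℝ} (hR : 1 ≤ R)
    (h : 80 * (Real.log (4 * R) * √(Real.log (4 * R))) < √R) : 17 ≤ Real.log (4 * R) := by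
  set L := Real.log (4 * R) with hL
  have hL1 : 1 ≤ L := by
    have := one_add_log_le_log_four_mul (by linarith : 0 < R)
    linarith [Real.log_nonneg hR]
  have h1 : 6400 * L ^ 3 < R := by
    have h2 : (80 * (L * √L)) ^ 2 < √R ^ 2 := by
      have : 0 ≤ 80 * (L * √L) := by positivity
      gcongr
    rw [Real.sq_sqrt (by linarith), mul_pow, mul_pow, Real.sq_sqrt (by linarith)] at h2
    linarith
  -- A bootstrap on `25600 L³ < 4R = e^L`: `L ≥ 1` gives `L ≥ 10` since `e^10 < 25600`, and this
  -- gives `L ≥ 17` since `e^17 < 25600000`.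
  have key : ∀ (n : ℕ) (x : ℝ), x ≤ 25600 * L ^ 3 → (2.7182818286 : ℝ) ^ n ≤ x → (n : ℝ) ≤ L := by
    intro n x hx hn
    rw [hL, Real.le_log_iff_exp_le (by linarith)]
    have h2 : Real.exp n = Real.exp 1 ^ n := by rw [← Real.exp_nat_mul]; simp
    have h3 : Real.exp 1 ^ n ≤ (2.7182818286 : ℝ) ^ n := by
      have := Real.exp_one_lt_d9.le
      gcongr
    linarith
  have h10 : (10 : ℝ) ≤ L := by
    have := key 10 25600 (by nlinarith [one_le_pow₀ hL1 (n := 3)]) (by norm_num)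
    exact_mod_cast this
  have h17 := key 17 25600000 (by
    have : (10 : ℝ) ^ 3 ≤ L ^ 3 := by gcongr
    linarith) (by norm_num)
  exact_mod_cast h17

/-! ### Trivial bound, reduction to large parameters, and conclusion -/

lemma norm_S_le {B α : ℝ} {f : ArithmeticFunction ℂ}
    (hf : BoundedMultiplicative B f) (N : ℕ) : ‖S f N α‖ ≤ B * N := by
  unfold S
  refine (norm_sum_le _ _).trans ?_
  calc _ ≤ ∑ n ∈ Icc 1 N, B := by
        refine sum_le_sum fun n _ => ?_
        rw [norm_mul, norm_e, mul_one]
        exact hf.2 n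
    _ = B * N := by simp [mul_comm]

/-- The bound with numerical constants. -/
theorem norm_S_le_of_approx {B : ℝ} (hB : 1 ≤ B) {f : ArithmeticFunction ℂ}
    (hf : BoundedMultiplicative B f) {N q : ℕ} {a : ℤ} {α R : ℝ}
    (hα : |α - (a : ℝ) / (q : ℝ)| ≤ 1 / (q : ℝ) ^ 2) (haq : IsCoprime a (q : ℤ)) (hR : 1 ≤ R)
    (hRq : R ≤ (q : ℝ)) (hqN : (q : ℝ) ≤ (N : ℝ) / R) (hN : 1 < N) :
    ‖S f N α‖ ≤ 4000 * B ^ 2 * (N / Real.log N)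
      + 80 * B ^ 2 * (N * (Real.log (4 * R) * √(Real.log (4 * R))) / √R) := by
  have hR0 : 0 < R := by linarith
  have hN1 : 1 ≤ N := hN.le
  have hN0 : (0 : ℝ) < N := by exact_mod_cast hN1
  have hlN : 0 < Real.log N := Real.log_pos (by exact_mod_cast hN)
  set l := Real.log N with hl
  set L := Real.log (4 * R) with hL
  have hL1 : 1 ≤ L := by
    have := one_add_log_le_log_four_mul hR0
    linarith [Real.log_nonneg hR]
  have hB2 : B ≤ B ^ 2 := by nlinarith
  have hsR : 0 < √R := Real.sqrt_pos.2 hR0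
  have htriv := norm_S_le (α := α) hf N
  -- When the trivial bound is not enough, each term on the right is smaller than `B² N`. This
  -- forces `l > 4000` and `80 L^{3/2} < √R`.
  by_cases hbig : B * N ≤ 4000 * B ^ 2 * (N / l) + 80 * B ^ 2 * (N * (L * √L) / √R)
  · exact htriv.trans hbig
  rw [not_le] at hbig
  have hA0 : 0 ≤ 4000 * B ^ 2 * (N / l) := by positivity
  have hD0 : 0 ≤ 80 * B ^ 2 * (N * (L * √L) / √R) := by positivity
  have hBN : B * N ≤ B ^ 2 * N := by gcongr
  have hBN0 : 0 < B ^ 2 * N := by positivity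
  have hl4000 : 4000 < l := by
    have h1 : 4000 * B ^ 2 * (N / l) < B ^ 2 * N := by linarith
    have h2 : 4000 * B ^ 2 * (N / l) = B ^ 2 * N * (4000 / l) := by ring
    rw [h2] at h1
    have h3 : 4000 / l < 1 := by
      by_contra hcon
      nlinarith
    rwa [div_lt_one hlN] at h3
  have hLR : 80 * (L * √L) < √R := by
    have h1 : 80 * B ^ 2 * (N * (L * √L) / √R) < B ^ 2 * N := by linarith
    have h2 : 80 * B ^ 2 * (N * (L * √L) / √R) = B ^ 2 * N * (80 * (L * √L) / √R) := by ring
    rw [h2] at h1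
    have h3 : 80 * (L * √L) / √R < 1 := by
      by_contra hcon
      nlinarith
    rwa [div_lt_one hsR] at h3
  have hL17 : 17 ≤ L := seventeen_le_log_of_lt hR hLR
  have h1 := norm_S_mul_log_le (α := α) hB hf N
  have h2 := norm_bilinear_total_le (f := f) haq hα hR hL17 hRq hqN hN1 (by linarith) hf.2
  rw [← hl] at h1
  rw [← hl, ← hL] at h2
  -- There are at most `2l` dyadic ranges, giving `2 · 160 L = 80 · 4 L ≤ 80 L √L`. The extra `√L`
  -- allowed by the theorem thus absorbs the numerical constant.
  have hsL : 4 ≤ √L := Real.le_sqrt_of_sq_le (by linarith)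
  have hlog2 := Real.log_two_gt_d9
  have h3 : l / Real.log 2 + 1 ≤ 2 * l := by
    have : l / Real.log 2 ≤ 1.5 * l := by
      rw [div_le_iff₀ (by linarith)]
      nlinarith
    linarith
  have h4 : (l / Real.log 2 + 1) * (160 * L / √R) ≤ 80 * (L * √L) / √R * l := by
    calc _ ≤ 2 * l * (160 * L / √R) := by gcongr
      _ = 80 * (L * 4) / √R * l := by ring
      _ ≤ _ := by gcongr
  have h5 : ‖S f N α‖ * l ≤ B ^ 2 * N * (4000 + 80 * (L * √L) / √R * l) := by
    have h6 : B ^ 2 * N * (3059 + (l / Real.log 2 + 1) * (160 * L / √R))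
        ≤ B ^ 2 * N * (3059 + 80 * (L * √L) / √R * l) := by gcongr
    linarith
  refine le_of_mul_le_mul_right (h5.trans (le_of_eq ?_)) hlN
  field_simp

end MontgomeryVaughan

theorem corollary1 (B : ℝ) (hB : 1 ≤ B)
    (f : ArithmeticFunction ℂ) (hf : MontgomeryVaughan.BoundedMultiplicative B f)
    (N q : ℕ) (a : ℤ) (α E R : ℝ)
    (hα : |α - (a : ℝ) / (q : ℝ)| ≤ 1 / (q : ℝ) ^ 2)
    (haq : IsCoprime a (q : ℤ))
    (hE : 4 ≤ E) (hER : Real.exp 3 / E ≤ R)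
    (hR : Real.exp 1 < R)
    (hRq : R ≤ (q : ℝ)) (hqN : (q : ℝ) ≤ (N : ℝ) / R) :
    ‖MontgomeryVaughan.S f N α‖ ≤
      MontgomeryVaughan.c₁ B E R * ((N : ℝ) / Real.log N)
        + MontgomeryVaughan.c₂ B E R q *
            ((N : ℝ) * Real.log (E * R) ^ (3 / 2 : ℝ) / √R) := by
  have hR1 : 1 ≤ R := by linarith [Real.add_one_le_exp 1]
  have hR0 : 0 < R := by linarith
  have hE0 : 0 < E := by linarith
  have hl3 : 3 ≤ Real.log (E * R) := by
    rw [div_le_iff₀ hE0] at hER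
    rw [Real.le_log_iff_exp_le (by positivity)]
    linarith
  have hlq : 1 ≤ Real.log q := by
    rw [Real.le_log_iff_exp_le (by linarith)]
    linarith
  have hqR : (q : ℝ) * R ≤ N := by rwa [le_div_iff₀ hR0] at hqN
  have hNe : Real.exp 1 < N := by nlinarith
  have hN0 : (0 : ℝ) < N := (Real.exp_pos 1).trans hNe
  have hN1' : (1 : ℝ) < N := by linarith [Real.add_one_le_exp 1]
  have hN1 : 1 < N := by exact_mod_cast hN1'
  have hlN : 0 < Real.log N := Real.log_pos hN1'
  have hc1 := MontgomeryVaughan.c₁_ge hB hE hR1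
  have hc2 := MontgomeryVaughan.c₂_ge (B := B) hE hl3 hR hlq
  set C₁ := MontgomeryVaughan.c₁ B E R
  set C₂ := MontgomeryVaughan.c₂ B E R q
  set l := Real.log N with hl
  set L := Real.log (4 * R) with hL
  have hLl : L ≤ Real.log (E * R) := Real.log_le_log (by positivity) (by gcongr)
  have hL1 : 1 ≤ L := by
    have := MontgomeryVaughan.one_add_log_le_log_four_mul hR0
    linarith [Real.log_nonneg hR1]
  have hsR : 0 < √R := Real.sqrt_pos.2 hR0
  have hC₂ : 0 ≤ C₂ := le_trans (by positivity) hc2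
  have hmain : 4000 * B ^ 2 * (N / l) + 80 * B ^ 2 * (N * (L * √L) / √R)
      ≤ C₁ * (N / l) + C₂ * (N * Real.log (E * R) ^ (3 / 2 : ℝ) / √R) := by
    rw [← MontgomeryVaughan.rpow_three_halves (by linarith : 0 < L)]
    gcongr
  exact (MontgomeryVaughan.norm_S_le_of_approx hB hf hα haq hR1 hRq hqN hN1).trans hmain
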